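/- Let $\mathbb T=\mathbb R/2\pi\mathbb Z$, let $g\in C^2(\mathbb R,\mathbb R)$, $T>0$ and $M_1,M_2\in\mathbb R$. Then there are a constant $C>0$ and a maximum step size $\tau_0>0$, depending only on $g,T,M_1,M_2$, such that the following holds. Let $u$ be a real-valued solution of the periodic semilinear wave equation $$\partial_t^2u-\partial_x^2u=g(u)\quad\text{on }[0,T]\times\mathbb T$$ with $(u,\partial_tu)\in C([0,T],H^1(\mathbb T)\times L^2(\mathbb T))\cap C^1([0,T],L^2(\mathbb T)\times H^{-1}(\mathbb T))$ (the equation being satisfied in $H^{-1}(\mathbb T)$ for every $t\in[0,T]$) and $$\|u(t)\|_{H^1(\mathbb T)}\le M_1,\qquad \|\partial_tu(t)\|_{L^2(\mathbb T)}\le M_2\qquad\text{for all }t\in[0,T].$$ Let $A(\phi,\psi)=(\psi,\partial_x^2\phi)$ be the wave operator, let $(e^{tA})_{t\in\mathbb R}$ be the group it generates on $H^1(\mathbb T)\times L^2(\mathbb T)$, and let $$\varphi_2(-2\tau A)w=\frac1{\tau^2}\int_0^\tau(\tau-s)\,e^{-2sA}w\,\mathrm ds,\qquad w\in H^1(\mathbb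 T)\times L^2(\mathbb T).$$ For $\tau>0$ define the approximations $(u_n,v_n)\in H^1(\mathbb T)\times L^2(\mathbb T)$ of the corrected Lie splitting by $(u_0,v_0)=(u(0),\partial_tu(0))$ and $$\begin{pmatrix}u_{n+1}\\v_{n+1}\end{pmatrix}=e^{\tau A}\left[\begin{pmatrix}u_n\\v_n\end{pmatrix}+\tau\begin{pmatrix}0\\g(u_n)\end{pmatrix}+\tau^2\varphi_2(-2\tau A)\begin{pmatrix}-g(u_n)\\g'(u_n)v_n\end{pmatrix}\right].$$ Then $$\|u(n\tau)-u_n\|_{H^1(\mathbb T)}+\|\partial_tu(n\tau)-v_n\|_{L^2(\mathbb T)}\le C\tau^2$$ for all $\tau\in(0,\tau_0]$ and all $n\in\mathbb N_0$ with $n\tau\le T$. -/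

import Mathlib

namespace WaveTorus

open MeasureTheory Set
open scoped ContDiff RealInnerProductSpace

noncomputable section

instance twoPiPos : Fact (0 < 2 * Real.pi) := ⟨Real.two_pi_pos⟩

/-- The torus `ℝ / 2πℤ`, with its Lebesgue measure `volume` of total mass `2π`. -/
abbrev Torus : Type := AddCircle (2 * Real.pi)

/-- The real Hilbert space `L²(𝕋)`. -/
abbrev L2 : Type := Lp ℝ 2 (volume : Measure Torus)

/-- The derivative of a function on the torus. -/
def torusDeriv (φ : Torus → ℝ) (x : Torus) : ℝ := deriv (fun t : ℝ => φ (x + (t : Torus))) 0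

/-- Smooth real functions on the torus. -/
def IsSmooth (φ : Torus → ℝ) : Prop := ContDiff ℝ ∞ (fun t : ℝ => φ (t : Torus))

/-- `f'` is the weak derivative of `f`. -/
def IsWeakDeriv (f f' : L2) : Prop :=
  ∀ φ : Torus → ℝ, IsSmooth φ → ∫ x, f x * torusDeriv φ x = -∫ x, f' x * φ x

theorem IsSmooth.hasDerivAt {φ : Torus → ℝ} (h : IsSmooth φ) (x : Torus) (t : ℝ) :
    HasDerivAt (fun t : ℝ => φ (x + (t : Torus))) (torusDeriv φ (x + (t : Torus))) t := by
  obtain ⟨y, rfl⟩ := QuotientAddGroup.mk_surjective x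
  have hd : Differentiable ℝ (fun t : ℝ => φ (t : Torus)) := h.differentiable (by simp)
  have key : ∀ s : ℝ, HasDerivAt (fun t : ℝ => φ ((y : Torus) + (t : Torus)))
      (deriv (fun t : ℝ => φ (t : Torus)) (y + s)) s := by
    intro s
    have := (hd (y + s)).hasDerivAt.comp_const_add y s
    simpa [AddCircle.coe_add] using this
  have e : torusDeriv φ ((y : Torus) + (t : Torus)) =
      deriv (fun t : ℝ => φ (t : Torus)) (y + t) := by
    have := ((hd (y + t + 0)).hasDerivAt.comp_const_add (y + t) 0).deriv
    simpa [torusDeriv, AddCircle.coe_add] using this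
  have := key t
  rw [← e] at this
  exact this

theorem torusDeriv_coe (φ : Torus → ℝ) (t : ℝ) :
    torusDeriv φ (t : Torus) = deriv (fun s : ℝ => φ (s : Torus)) t := by
  have := deriv_comp_const_add (f := fun s : ℝ => φ (s : Torus)) t 0
  simpa [torusDeriv, AddCircle.coe_add] using this

theorem IsSmooth.deriv {φ : Torus → ℝ} (h : IsSmooth φ) : IsSmooth (torusDeriv φ) := by
  unfold IsSmooth at *
  simp only [torusDeriv_coe]
  exact (contDiff_infty_iff_deriv.1 h).2

theorem IsSmooth.continuous {φ : Torus → ℝ} (h : IsSmooth φ) : Continuous φ := by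
  have : Continuous (fun t : ℝ => φ (t : Torus)) := ContDiff.continuous h
  exact (QuotientAddGroup.isQuotientMap_mk _).continuous_iff.2 this

theorem IsSmooth.memLp {φ : Torus → ℝ} (h : IsSmooth φ) : MemLp φ 2 (volume : Measure Torus) := by
  obtain ⟨C, hC⟩ := isCompact_univ.exists_bound_of_continuousOn h.continuous.continuousOn
  exact MemLp.of_bound h.continuous.aestronglyMeasurable C
    (Filter.Eventually.of_forall fun x => hC x (mem_univ x))

theorem integrable_mul_smooth (f : L2) {φ : Torus → ℝ} (h : IsSmooth φ) :
    Integrable (fun x => f x * φ x) (volume : Measure Torus) :=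
  (Lp.memLp f).integrable_mul h.memLp

/-- The graph of the weak derivative: pairs `(f, f')` in `L² × L²` with `f'` the weak derivative
of `f`.  It carries the norm `(‖f‖² + ‖f'‖²)^(1/2)`. -/
def sobolev : Submodule ℝ (WithLp 2 (L2 × L2)) where
  carrier := {p | IsWeakDeriv p.fst p.snd}
  zero_mem' := by
    intro φ _
    have e : ∀ ψ : Torus → ℝ, ∫ x, ((0 : L2) : Torus → ℝ) x * ψ x = 0 := by
      intro ψ
      refine integral_eq_zero_of_ae ?_
      filter_upwards [Lp.coeFn_zero ℝ 2 (volume : Measure Torus)] with x hx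
      rw [hx]
      simp
    rw [WithLp.zero_fst, WithLp.zero_snd, e, e, neg_zero]
  add_mem' := by
    intro p q hp hq φ hφ
    have e : ∀ (a b : L2) {ψ : Torus → ℝ}, IsSmooth ψ →
        ∫ x, ((a + b : L2) : Torus → ℝ) x * ψ x = (∫ x, a x * ψ x) + ∫ x, b x * ψ x := by
      intro a b ψ hψ
      rw [← integral_add (integrable_mul_smooth a hψ) (integrable_mul_smooth b hψ)]
      refine integral_congr_ae ?_
      filter_upwards [Lp.coeFn_add a b] with x hx
      simp only [hx, Pi.add_apply, add_mul]
    rw [WithLp.add_fst, WithLp.add_snd, e _ _ hφ.deriv, e _ _ hφ, hp φ hφ, hq φ hφ]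
    ring
  smul_mem' := by
    intro c p hp φ hφ
    have e : ∀ (a : L2) (ψ : Torus → ℝ),
        ∫ x, ((c • a : L2) : Torus → ℝ) x * ψ x = c * (∫ x, a x * ψ x) := by
      intro a ψ
      rw [← integral_const_mul]
      refine integral_congr_ae ?_
      filter_upwards [Lp.coeFn_smul c a] with x hx
      simp only [hx, Pi.smul_apply, smul_eq_mul, mul_assoc]
    rw [WithLp.smul_fst, WithLp.smul_snd, e, e, hp φ hφ]
    ring

/-- The real Hilbert space `H¹(𝕋)`. -/
abbrev H1 : Type := sobolev

namespace H1

/-- The embedding `H¹(𝕋) → L²(𝕋)`. -/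
def toL2 : H1 →L[ℝ] L2 := (WithLp.fstL 2 ℝ L2 L2).comp sobolev.subtypeL

/-- The weak derivative `∂ₓ : H¹(𝕋) → L²(𝕋)`. -/
def deriv : H1 →L[ℝ] L2 := (WithLp.sndL 2 ℝ L2 L2).comp sobolev.subtypeL

theorem norm_sq (u : H1) : ‖u‖ ^ 2 = ‖toL2 u‖ ^ 2 + ‖deriv u‖ ^ 2 :=
  WithLp.prod_norm_sq_eq_of_L2 _

end H1

/-- `H⁻¹(𝕋)`, the dual space of `H¹(𝕋)`, with the dual norm. -/
def Hneg1 : Type := H1 →L[ℝ] ℝ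

instance : NormedAddCommGroup Hneg1 := inferInstanceAs (NormedAddCommGroup (H1 →L[ℝ] ℝ))

instance : NormedSpace ℝ Hneg1 := inferInstanceAs (NormedSpace ℝ (H1 →L[ℝ] ℝ))

/-- The identification of `H⁻¹(𝕋)` with the space of continuous linear functionals on `H¹(𝕋)`. -/
def Hneg1.ofDual : (H1 →L[ℝ] ℝ) ≃ₗᵢ[ℝ] Hneg1 := LinearIsometryEquiv.refl ℝ (H1 →L[ℝ] ℝ)

instance : FunLike Hneg1 H1 ℝ := inferInstanceAs (FunLike (H1 →L[ℝ] ℝ) H1 ℝ)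

/-- The embedding `L²(𝕋) → H⁻¹(𝕋)`, `f ↦ (w ↦ ⟪f, w⟫)`. -/
def Hneg1.ofL2 : L2 →L[ℝ] Hneg1 :=
  Hneg1.ofDual.toContinuousLinearEquiv.toContinuousLinearMap.comp
    ((ContinuousLinearMap.precomp ℝ H1.toL2).comp (innerSL ℝ : L2 →L[ℝ] L2 →L[ℝ] ℝ))

/-- The derivative `∂ₓ : L²(𝕋) → H⁻¹(𝕋)`, `f ↦ (w ↦ -⟪f, ∂ₓ w⟫)`. -/
def Hneg1.deriv : L2 →L[ℝ] Hneg1 :=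
  -Hneg1.ofDual.toContinuousLinearEquiv.toContinuousLinearMap.comp
    ((ContinuousLinearMap.precomp ℝ H1.deriv).comp (innerSL ℝ : L2 →L[ℝ] L2 →L[ℝ] ℝ))

theorem Hneg1.ofL2_apply (f : L2) (w : H1) : Hneg1.ofL2 f w = ⟪f, H1.toL2 w⟫ := rfl

theorem Hneg1.deriv_apply (f : L2) (w : H1) : Hneg1.deriv f w = -⟪f, H1.deriv w⟫ := rfl

/-- Translation `(S_t f)(x) = f (x + t)` on `L²(𝕋)`. -/
def translate (t : ℝ) : L2 →ₗᵢ[ℝ] L2 :=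
  Lp.compMeasurePreservingₗᵢ ℝ (fun x : Torus => x + (t : Torus))
    (measurePreserving_add_right volume (t : Torus))

theorem coeFn_translate (t : ℝ) (f : L2) :
    translate t f =ᵐ[volume] fun x => f (x + (t : Torus)) :=
  Lp.coeFn_compMeasurePreserving f (measurePreserving_add_right volume (t : Torus))

theorem continuous_translate (f : L2) : Continuous (fun t : ℝ => translate t f) := by
  have h1 : Continuous (fun t : ℝ => (⟨fun x : Torus => x + (t : Torus), by fun_prop⟩ : C(Torus, Torus))) := by
    refine ContinuousMap.continuous_of_continuous_uncurry _ ?_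
    have : Continuous (fun t : ℝ => (t : Torus)) := AddCircle.continuous_mk' _
    exact continuous_snd.add (this.comp continuous_fst)
  exact Continuous.compMeasurePreservingLp (E := ℝ) (p := 2) (f := fun _ : ℝ => f)
    (g := fun t : ℝ => (⟨fun x : Torus => x + (t : Torus), by fun_prop⟩ : C(Torus, Torus)))
    continuous_const h1 (fun t => measurePreserving_add_right volume (t : Torus)) (by simp)

theorem integral_translate (t : ℝ) (f : L2) (φ : Torus → ℝ) :
    ∫ x, translate t f x * φ x = ∫ x, f x * φ (x + ((-t : ℝ) : Torus)) := by
  rw [← integral_add_right_eq_self (μ := (volume : Measure Torus))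
    (fun x => f x * φ (x + ((-t : ℝ) : Torus))) (t : Torus)]
  refine integral_congr_ae ?_
  filter_upwards [coeFn_translate t f] with x hx
  rw [hx]
  simp

theorem inner_toLp (f : L2) {φ : Torus → ℝ} (h : IsSmooth φ) :
    ⟪h.memLp.toLp φ, f⟫ = ∫ x, f x * φ x := by
  rw [L2.inner_def]
  refine integral_congr_ae ?_
  filter_upwards [h.memLp.coeFn_toLp] with x hx
  rw [hx]
  simp [mul_comm]

theorem hasDerivAt_integral_translate (f : L2) {φ : Torus → ℝ} (h : IsSmooth φ) (t : ℝ) :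
    HasDerivAt (fun s => ∫ x, translate s f x * φ x)
      (-∫ x, translate t f x * torusDeriv φ x) t := by
  simp only [integral_translate]
  rw [← integral_neg]
  obtain ⟨C, hC⟩ := isCompact_univ.exists_bound_of_continuousOn h.deriv.continuous.continuousOn
  have hcoe : ∀ {ψ : Torus → ℝ}, IsSmooth ψ → ∀ s : ℝ,
      Continuous fun x : Torus => ψ (x + (s : Torus)) := fun hψ s =>
    hψ.continuous.comp (continuous_id.add continuous_const)
  have hbd : ∀ {ψ : Torus → ℝ}, IsSmooth ψ → ∀ s : ℝ,
      Integrable (fun x => f x * ψ (x + (s : Torus))) (volume : Measure Torus) := by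
    intro ψ hψ s
    obtain ⟨D, hD⟩ := isCompact_univ.exists_bound_of_continuousOn hψ.continuous.continuousOn
    exact ((Lp.memLp f).integrable (by norm_num)).mul_bdd
      (hcoe hψ s).aestronglyMeasurable (Filter.Eventually.of_forall fun x => hD _ (mem_univ _))
  refine (hasDerivAt_integral_of_dominated_loc_of_deriv_le (s := univ)
    (F' := fun s x => -(f x * torusDeriv φ (x + ((-s : ℝ) : Torus))))
    (bound := fun x => |f x| * C) Filter.univ_mem ?_ ?_ ?_ ?_ ?_ ?_).2
  · exact Filter.Eventually.of_forall fun s => (hbd h (-s)).aestronglyMeasurable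
  · exact hbd h (-t)
  · exact (hbd h.deriv (-t)).neg.aestronglyMeasurable
  · refine Filter.Eventually.of_forall fun x s _ => ?_
    rw [norm_neg, norm_mul]
    exact mul_le_mul_of_nonneg_left (hC _ (mem_univ _)) (abs_nonneg _)
  · exact ((Lp.memLp f).integrable (by norm_num)).abs.mul_const C
  · refine Filter.Eventually.of_forall fun x s _ => ?_
    have := ((h.hasDerivAt x (-s)).comp s (hasDerivAt_neg s)).const_mul (f x)
    simpa using this

theorem IsSmooth.shift {φ : Torus → ℝ} (h : IsSmooth φ) (s : ℝ) :
    IsSmooth (fun x => φ (x + (s : Torus))) := by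
  have : ContDiff ℝ ∞ (fun t : ℝ => φ ((t + s : ℝ) : Torus)) :=
    ContDiff.comp (g := fun t : ℝ => φ (t : Torus)) h (contDiff_id.add contDiff_const)
  simpa [IsSmooth, AddCircle.coe_add] using this

theorem torusDeriv_shift (φ : Torus → ℝ) (s : ℝ) (x : Torus) :
    torusDeriv (fun x => φ (x + (s : Torus))) x = torusDeriv φ (x + (s : Torus)) := by
  simp only [torusDeriv, add_right_comm]

theorem IsWeakDeriv.translate {f f' : L2} (h : IsWeakDeriv f f') (t : ℝ) :
    IsWeakDeriv (translate t f) (translate t f') := by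
  intro φ hφ
  rw [integral_translate, integral_translate, ← h _ (hφ.shift (-t))]
  simp only [torusDeriv_shift]

theorem isWeakDeriv_integral_translate (f : L2) (a b : ℝ) :
    IsWeakDeriv (∫ s in a..b, translate s f) (translate b f - translate a f) := by
  intro φ hφ
  have hc := continuous_translate f
  rw [← inner_toLp _ hφ.deriv, ← inner_toLp _ hφ]
  have h1 : ⟪hφ.deriv.memLp.toLp (torusDeriv φ), ∫ s in a..b, translate s f⟫
      = ∫ s in a..b, ⟪hφ.deriv.memLp.toLp (torusDeriv φ), translate s f⟫ :=
    ((innerSL ℝ (hφ.deriv.memLp.toLp (torusDeriv φ))).intervalIntegral_comp_comm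
      (hc.intervalIntegrable a b)).symm
  have h2 : ∫ s in a..b, -⟪hφ.deriv.memLp.toLp (torusDeriv φ), translate s f⟫
      = ⟪hφ.memLp.toLp φ, translate b f⟫ - ⟪hφ.memLp.toLp φ, translate a f⟫ := by
    refine intervalIntegral.integral_eq_sub_of_hasDerivAt
      (f := fun s => ⟪hφ.memLp.toLp φ, translate s f⟫) (fun s _ => ?_)
      ((continuous_const.inner hc).neg.intervalIntegrable a b)
    have e : (fun s => ⟪hφ.memLp.toLp φ, translate s f⟫)
        = fun s => ∫ x, translate s f x * φ x := funext fun s => inner_toLp _ hφ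
    rw [e, inner_toLp _ hφ.deriv]
    exact hasDerivAt_integral_translate f hφ s
  rw [intervalIntegral.integral_neg] at h2
  rw [h1, inner_sub_right]
  linarith

/-- The displacement at time `t` of the free wave with initial displacement `w.1 = φ₀` and initial
velocity `w.2 = φ₁`, i.e. `(φ₀(x+t) + φ₀(x-t) + ∫_{-t}^{t} φ₁(x+s) ds) / 2`, bundled with its weak
derivative in `x`. -/
def waveDisplacement (t : ℝ) (w : H1 × L2) : H1 :=
  ⟨WithLp.toLp 2
    ((1 / 2 : ℝ) • (translate t (H1.toL2 w.1) + translate (-t) (H1.toL2 w.1)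
        + ∫ s in (-t)..t, translate s w.2),
      (1 / 2 : ℝ) • (translate t (H1.deriv w.1) + translate (-t) (H1.deriv w.1)
        + (translate t w.2 - translate (-t) w.2))), by
    have hw : IsWeakDeriv (H1.toL2 w.1) (H1.deriv w.1) := w.1.2
    have h1 : WithLp.toLp 2 (translate t (H1.toL2 w.1), translate t (H1.deriv w.1)) ∈ sobolev :=
      hw.translate t
    have h2 : WithLp.toLp 2 (translate (-t) (H1.toL2 w.1), translate (-t) (H1.deriv w.1))
        ∈ sobolev := hw.translate (-t)
    have h3 : WithLp.toLp 2 (∫ s in (-t)..t, translate s w.2, translate t w.2 - translate (-t) w.2)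
        ∈ sobolev := isWeakDeriv_integral_translate w.2 (-t) t
    exact sobolev.smul_mem (1 / 2 : ℝ) (sobolev.add_mem (sobolev.add_mem h1 h2) h3)⟩

/-- The velocity at time `t` of the free wave with initial data `w = (φ₀, φ₁)`, i.e.
`(φ₀'(x+t) - φ₀'(x-t) + φ₁(x+t) + φ₁(x-t)) / 2`. -/
def waveVelocity (t : ℝ) (w : H1 × L2) : L2 :=
  (1 / 2 : ℝ) • (translate t (H1.deriv w.1) - translate (-t) (H1.deriv w.1)
    + (translate t w.2 + translate (-t) w.2))

/-- The group `e^{tA}` on `H¹(𝕋) × L²(𝕋)` generated by the wave operator `A (u, v) = (v, ∂ₓ² u)`.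
That `t ↦ e^{tA} w` starts at `w` and solves `∂ₜ W = A W` on `ℝ` is proved in `waveGroup_zero` and
`isWaveSolution_waveGroup`. -/
def waveGroup (t : ℝ) (w : H1 × L2) : H1 × L2 :=
  (waveDisplacement t w, waveVelocity t w)


theorem isClosed_sobolev : IsClosed (sobolev : Set (WithLp 2 (L2 × L2))) := by
  have e : (sobolev : Set (WithLp 2 (L2 × L2))) = ⋂ (φ : Torus → ℝ) (h : IsSmooth φ),
      {p | ⟪h.deriv.memLp.toLp (torusDeriv φ), p.fst⟫ = -⟪h.memLp.toLp φ, p.snd⟫} := by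
    ext p
    simp only [mem_iInter, mem_ofPred_eq]
    refine forall_congr' fun φ => forall_congr' fun h => ?_
    rw [inner_toLp _ h, inner_toLp _ h.deriv]
  rw [e]
  refine isClosed_iInter fun φ => isClosed_iInter fun h => isClosed_eq ?_ ?_
  · exact continuous_const.inner (WithLp.fstL 2 ℝ L2 L2).continuous
  · exact (continuous_const.inner (WithLp.sndL 2 ℝ L2 L2).continuous).neg

instance : CompleteSpace H1 := isClosed_sobolev.completeSpace_coe

/-- `(u, v)` is a solution, on the time set `I`, of the wave equation
`∂ₜ u = v`, `∂ₜ v = ∂ₓ² u + F` in the class `C(I, H¹ × L²) ∩ C¹(I, L² × H⁻¹)`.  The first equation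
holds in `L²` and the second one in `H⁻¹`, with (one-sided at the ends of `I`) norm derivatives.
If `F` is continuous in `H⁻¹`, the continuity of the time derivatives follows from the equations. -/
structure IsWaveSolution (F : ℝ → L2) (I : Set ℝ) (u : ℝ → H1) (v : ℝ → L2) : Prop where
  continuousOn_u : ContinuousOn u I
  continuousOn_v : ContinuousOn v I
  hasDerivWithinAt_u : ∀ t ∈ I, HasDerivWithinAt (fun s => H1.toL2 (u s)) (v t) I t
  hasDerivWithinAt_v : ∀ t ∈ I, HasDerivWithinAt (fun s => Hneg1.ofL2 (v s))
    (Hneg1.deriv (H1.deriv (u t)) + Hneg1.ofL2 (F t)) I t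

theorem eq_zero_of_forall_smooth (f : L2)
    (h : ∀ φ : Torus → ℝ, IsSmooth φ → ∫ x, f x * φ x = 0) : f = 0 := by
  have hf : MemLp (fun x => (f x : ℂ)) 2 (volume : Measure Torus) := (Lp.memLp f).ofReal
  have hf' : MemLp (fun x => (f x : ℂ)) 2 (AddCircle.haarAddCircle (T := 2 * Real.pi)) :=
    memLp_haarAddCircle_iff.2 hf
  have hs : ∀ n : ℤ, ContDiff ℝ ∞ (fun t : ℝ => (fourier n (t : Torus) : ℂ)) := by
    intro n
    simp only [fourier_coe_apply]
    have : ContDiff ℝ ∞ (fun t : ℝ => (t : ℂ)) := Complex.ofRealCLM.contDiff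
    fun_prop
  have hc : ∀ n : ℤ, fourierCoeff (fun x => (f x : ℂ)) n = 0 := by
    intro n
    have hre : IsSmooth (fun x => (fourier (-n) x : ℂ).re) :=
      Complex.reCLM.contDiff.comp (hs (-n))
    have him : IsSmooth (fun x => (fourier (-n) x : ℂ).im) :=
      Complex.imCLM.contDiff.comp (hs (-n))
    have hint : Integrable (fun x => (fourier (-n) x : ℂ) • (f x : ℂ))
        (volume : Measure Torus) := by
      refine (hf.integrable (by norm_num)).bdd_mul (c := 1)
        (fourier (-n)).continuous.aestronglyMeasurable
        (Filter.Eventually.of_forall fun x => ?_)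
      rw [fourier_apply, Circle.norm_coe]
    have h0 : ∫ x : Torus, (fourier (-n) x : ℂ) • (f x : ℂ) = 0 := by
      apply Complex.ext
      · have := (Complex.reCLM.integral_comp_comm hint)
        rw [Complex.zero_re, ← Complex.reCLM_apply, ← this, ← h _ hre]
        refine integral_congr_ae (Filter.Eventually.of_forall fun x => ?_)
        simp [mul_comm]
      · have := (Complex.imCLM.integral_comp_comm hint)
        rw [Complex.zero_im, ← Complex.imCLM_apply, ← this, ← h _ him]
        refine integral_congr_ae (Filter.Eventually.of_forall fun x => ?_)
        simp [mul_comm]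
    rw [fourierCoeff, AddCircle.integral_haarAddCircle, h0, smul_zero]
  have hz : hf'.toLp _ = 0 := by
    apply (fourierBasis (T := 2 * Real.pi)).repr.injective
    ext n
    rw [fourierBasis_repr, fourierCoeff_congr_ae hf'.coeFn_toLp, hc]
    simp
  have hz' : (fun x => (f x : ℂ)) =ᵐ[AddCircle.haarAddCircle (T := 2 * Real.pi)] 0 := by
    have := hf'.coeFn_toLp
    rw [hz] at this
    exact this.symm.trans (Lp.coeFn_zero _ _ _)
  have hz'' : (fun x => (f x : ℂ)) =ᵐ[(volume : Measure Torus)] 0 := by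
    have hv : (volume : Measure Torus) ≪ AddCircle.haarAddCircle (T := 2 * Real.pi) := by
      rw [AddCircle.volume_eq_smul_haarAddCircle]
      exact Measure.smul_absolutelyContinuous
    exact hv.ae_le hz'
  rw [Lp.eq_zero_iff_ae_eq_zero]
  filter_upwards [hz''] with x hx
  simpa using hx

theorem translate_sub_translate {f f' : L2} (h : IsWeakDeriv f f') (a b : ℝ) :
    translate b f - translate a f = ∫ s in a..b, translate s f' := by
  have hc := continuous_translate f'
  rw [← sub_eq_zero]
  refine eq_zero_of_forall_smooth _ fun φ hφ => ?_
  rw [← inner_toLp _ hφ, inner_sub_right, inner_sub_right]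
  have h1 : ⟪hφ.memLp.toLp φ, ∫ s in a..b, translate s f'⟫
      = ∫ s in a..b, ⟪hφ.memLp.toLp φ, translate s f'⟫ :=
    ((innerSL ℝ (hφ.memLp.toLp φ)).intervalIntegral_comp_comm
      (hc.intervalIntegrable a b)).symm
  rw [h1, sub_eq_zero, eq_comm]
  refine intervalIntegral.integral_eq_sub_of_hasDerivAt
    (f := fun s => ⟪hφ.memLp.toLp φ, translate s f⟫) (fun s _ => ?_)
    ((continuous_const.inner hc).intervalIntegrable a b)
  have e : (fun s => ⟪hφ.memLp.toLp φ, translate s f⟫)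
      = fun s => ∫ x, translate s f x * φ x := funext fun s => inner_toLp _ hφ
  rw [e, inner_toLp _ hφ]
  have := hasDerivAt_integral_translate f hφ s
  rwa [(h.translate s) φ hφ, neg_neg] at this

theorem hasDerivAt_translate {f f' : L2} (h : IsWeakDeriv f f') (t : ℝ) :
    HasDerivAt (fun s => translate s f) (translate t f') t := by
  have h1 := intervalIntegral.integral_hasDerivAt_right
    ((continuous_translate f').intervalIntegrable 0 t)
    ((continuous_translate f').stronglyMeasurableAtFilter _ _)
    (continuous_translate f').continuousAt
  have e : (fun s => translate s f) = fun s => (∫ r in (0 : ℝ)..s, translate r f') + translate 0 f := by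
    funext s
    rw [← translate_sub_translate h 0 s, sub_add_cancel]
  rw [e]
  exact h1.add_const _


theorem translate_zero (f : L2) : translate 0 f = f := by
  apply Lp.ext
  filter_upwards [coeFn_translate 0 f] with x hx
  simp [hx]

theorem IsWeakDeriv.inner_add_inner {f f' g g' : L2} (hf : IsWeakDeriv f f')
    (hg : IsWeakDeriv g g') : ⟪f, g'⟫ + ⟪f', g⟫ = 0 := by
  have h := (hasDerivAt_translate hf 0).inner ℝ (hasDerivAt_translate hg 0)
  simp only [LinearIsometry.inner_map_map] at h
  exact h.unique (hasDerivAt_const 0 _)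

theorem Hneg1.ofL2_sub (f : L2) (a b : ℝ) :
    ofL2 (translate b f) - ofL2 (translate a f) = deriv (∫ s in a..b, translate s f) := by
  refine DFunLike.ext _ _ fun w => ?_
  have hw : IsWeakDeriv (H1.toL2 w) (H1.deriv w) := w.2
  have h := (isWeakDeriv_integral_translate f a b).inner_add_inner hw
  change ⟪translate b f, H1.toL2 w⟫ - ⟪translate a f, H1.toL2 w⟫
    = -⟪∫ s in a..b, translate s f, H1.deriv w⟫
  rw [inner_sub_left] at h
  linarith

theorem Hneg1.hasDerivAt_ofL2_translate (f : L2) (t : ℝ) :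
    HasDerivAt (fun s => Hneg1.ofL2 (translate s f)) (Hneg1.deriv (translate t f)) t := by
  have h1 := intervalIntegral.integral_hasDerivAt_right
    ((continuous_translate f).intervalIntegrable 0 t)
    ((continuous_translate f).stronglyMeasurableAtFilter _ _)
    (continuous_translate f).continuousAt
  have h2 := (Hneg1.deriv.hasFDerivAt.comp_hasDerivAt t h1).add_const (Hneg1.ofL2 (translate 0 f))
  have e : (fun s => Hneg1.ofL2 (translate s f))
      = fun s => (Hneg1.deriv ∘ fun s => ∫ r in (0 : ℝ)..s, translate r f) s + Hneg1.ofL2 (translate 0 f) := by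
    funext s
    rw [Function.comp_apply, ← Hneg1.ofL2_sub, sub_add_cancel]
  rw [e]
  exact h2

theorem waveGroup_zero (w : H1 × L2) : waveGroup 0 w = w := by
  refine Prod.ext (Subtype.ext ?_) ?_
  · refine (WithLp.ofLp_injective 2) (Prod.ext ?_ ?_)
    · change (1 / 2 : ℝ) • (translate 0 (H1.toL2 w.1) + translate (-0) (H1.toL2 w.1)
        + ∫ s in (-0)..0, translate s w.2) = H1.toL2 w.1
      rw [neg_zero, translate_zero, intervalIntegral.integral_same]
      module
    · change (1 / 2 : ℝ) • (translate 0 (H1.deriv w.1) + translate (-0) (H1.deriv w.1)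
        + (translate 0 w.2 - translate (-0) w.2)) = H1.deriv w.1
      rw [neg_zero, translate_zero, translate_zero]
      module
  · change waveVelocity 0 w = w.2
    rw [waveVelocity, neg_zero, translate_zero, translate_zero]
    module

theorem isWaveSolution_waveGroup (w : H1 × L2) :
    IsWaveSolution 0 univ (fun t => (waveGroup t w).1) (fun t => (waveGroup t w).2) := by
  have hc := continuous_translate
  have hc' : ∀ f : L2, Continuous (fun t : ℝ => translate (-t) f) := fun f =>
    (hc f).comp continuous_neg
  have hD : ∀ (f : L2) (t : ℝ), HasDerivAt (fun s => ∫ r in (-s)..s, translate r f)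
      (translate t f + translate (-t) f) t := by
    intro f t
    have h1 : ∀ t, HasDerivAt (fun s => ∫ r in (0 : ℝ)..s, translate r f) (translate t f) t :=
      fun t => intervalIntegral.integral_hasDerivAt_right
        ((hc f).intervalIntegrable 0 t) ((hc f).stronglyMeasurableAtFilter _ _) (hc f).continuousAt
    have h2 := (h1 t).sub ((h1 (-t)).scomp t (hasDerivAt_neg t))
    have e : (fun s => ∫ r in (-s)..s, translate r f)
        = (fun s => ∫ r in (0 : ℝ)..s, translate r f)
          - ((fun s => ∫ r in (0 : ℝ)..s, translate r f) ∘ Neg.neg) := by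
      funext s
      exact (intervalIntegral.integral_interval_sub_left ((hc f).intervalIntegrable _ _)
        ((hc f).intervalIntegrable _ _)).symm
    rw [e]
    simpa using h2
  have hw : IsWeakDeriv (H1.toL2 w.1) (H1.deriv w.1) := w.1.2
  refine ⟨Continuous.continuousOn ?_, Continuous.continuousOn ?_, fun t _ => ?_, fun t _ => ?_⟩
  · refine Continuous.subtype_mk ((WithLp.prod_continuous_toLp 2 L2 L2).comp
      (Continuous.prodMk ?_ ?_)) _
    · exact Continuous.const_smul (((hc _).add (hc' _)).add
        (continuous_iff_continuousAt.2 fun t => (hD w.2 t).continuousAt)) (1 / 2 : ℝ)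
    · exact Continuous.const_smul (((hc _).add (hc' _)).add ((hc _).sub (hc' _))) (1 / 2 : ℝ)
  · exact Continuous.const_smul (((hc _).sub (hc' _)).add ((hc _).add (hc' _))) (1 / 2 : ℝ)
  · have h1 := hasDerivAt_translate hw
    have h := (((h1 t).add ((h1 (-t)).scomp t (hasDerivAt_neg t))).add (hD w.2 t)).const_smul
      (1 / 2 : ℝ)
    refine HasDerivAt.hasDerivWithinAt (HasDerivAt.congr_deriv h ?_)
    change _ = waveVelocity t w
    rw [waveVelocity]
    module
  · have h1 := Hneg1.hasDerivAt_ofL2_translate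
    have h1' : ∀ f t, HasDerivAt (fun s => Hneg1.ofL2 (translate (-s) f))
        (-Hneg1.deriv (translate (-t) f)) t := fun f t => by
      
      have := HasDerivAt.scomp (F := Hneg1) t (h1 f (-t)) (hasDerivAt_neg t)
      rwa [neg_one_smul] at this
    have h2 : HasDerivAt (fun s => Hneg1.ofL2 (translate s (H1.deriv w.1))
        - Hneg1.ofL2 (translate (-s) (H1.deriv w.1)))
        (Hneg1.deriv (translate t (H1.deriv w.1)) - -Hneg1.deriv (translate (-t) (H1.deriv w.1))) t :=
      HasDerivAt.fun_sub (F := Hneg1) (h1 _ t) (h1' _ t)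
    have h3 : HasDerivAt (fun s => Hneg1.ofL2 (translate s w.2)
        + Hneg1.ofL2 (translate (-s) w.2))
        (Hneg1.deriv (translate t w.2) + -Hneg1.deriv (translate (-t) w.2)) t :=
      HasDerivAt.fun_add (F := Hneg1) (h1 _ t) (h1' _ t)
    have h := HasDerivAt.fun_const_smul (F := Hneg1) (1 / 2 : ℝ) (HasDerivAt.fun_add (F := Hneg1) h2 h3)
    have e : (fun s => Hneg1.ofL2 (waveGroup s w).2) = fun s => (1 / 2 : ℝ) •
        (Hneg1.ofL2 (translate s (H1.deriv w.1)) - Hneg1.ofL2 (translate (-s) (H1.deriv w.1))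
          + (Hneg1.ofL2 (translate s w.2) + Hneg1.ofL2 (translate (-s) w.2))) := by
      funext s
      change Hneg1.ofL2 (waveVelocity s w) = _
      simp only [waveVelocity, map_smul, map_add, map_sub]
    rw [e]
    refine HasDerivAt.hasDerivWithinAt (HasDerivAt.congr_deriv h ?_)
    have e2 : H1.deriv (waveGroup t w).1 = (1 / 2 : ℝ) • (translate t (H1.deriv w.1)
        + translate (-t) (H1.deriv w.1) + (translate t w.2 - translate (-t) w.2)) := rfl
    rw [e2, Pi.zero_apply]
    simp only [map_smul, map_add, map_sub, map_zero]
    module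

/-- The element of `L²(𝕋)` given by a function on the torus (`0` if the function is not square
integrable). -/
def classL2 (f : Torus → ℝ) : L2 :=
  haveI := Classical.propDecidable (MemLp f 2 (volume : Measure Torus))
  if h : MemLp f 2 (volume : Measure Torus) then h.toLp f else 0

/-- The nonlinearity `g(u) ∈ L²(𝕋)` for `u ∈ H¹(𝕋)`.  For continuous `g` the function `g ∘ u` is
bounded because `u` is, so it is in `L²(𝕋)`. -/
def nonlin (g : ℝ → ℝ) (u : H1) : L2 := classL2 (fun x => g (H1.toL2 u x))

/-- The nonlinearity `g(u)` as an element of `H¹(𝕋)`: the unique `w ∈ H¹(𝕋)` with `w = g ∘ u` almost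
everywhere.  It exists for `g` of class `C¹` by the chain rule, `∂ₓ w = g'(u) ∂ₓ u`. -/
def nonlinH1 (g : ℝ → ℝ) (u : H1) : H1 :=
  haveI := Classical.propDecidable (∃ w : H1, H1.toL2 w =ᵐ[volume] fun x => g (H1.toL2 u x))
  if h : ∃ w : H1, H1.toL2 w =ᵐ[volume] fun x => g (H1.toL2 u x) then h.choose else 0

/-- The product `g'(u) v ∈ L²(𝕋)` for `u ∈ H¹(𝕋)` and `v ∈ L²(𝕋)`. -/
def nonlinDeriv (g : ℝ → ℝ) (u : H1) (v : L2) : L2 :=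
  classL2 (fun x => _root_.deriv g (H1.toL2 u x) * v x)

/-- `(u, v)` with `v = ∂ₜ u` is a solution of the semilinear wave equation `∂ₜ² u - ∂ₓ² u = g(u)` on
`[0,T] × 𝕋` in the class `C([0,T], H¹ × L²) ∩ C¹([0,T], L² × H⁻¹)`. -/
def IsSemilinearWaveSolution (g : ℝ → ℝ) (T : ℝ) (u : ℝ → H1) (v : ℝ → L2) : Prop :=
  IsWaveSolution (fun t => nonlin g (u t)) (Icc 0 T) u v

/-- `φ₂(-2τA) w = τ⁻² ∫₀^τ (τ - s) e^{-2sA} w ds`. -/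
def phi2 (τ : ℝ) (w : H1 × L2) : H1 × L2 :=
  (1 / τ ^ 2) • ∫ s in (0 : ℝ)..τ, (τ - s) • waveGroup (-2 * s) w

/-- One step of the corrected Lie splitting,
`U ↦ e^{τA} [U + τ (0, g(u)) + τ² φ₂(-2τA) (-g(u), g'(u) v)]` for `U = (u, v)`. -/
def correctedLieStep (g : ℝ → ℝ) (τ : ℝ) (U : H1 × L2) : H1 × L2 :=
  waveGroup τ (U + τ • ((0 : H1), nonlin g U.1)
    + τ ^ 2 • phi2 τ (-nonlinH1 g U.1, nonlinDeriv g U.1 U.2))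

/-- The approximations `(uₙ, vₙ)` of the corrected Lie splitting with step size `τ` and initial
value `U₀`. -/
def correctedLie (g : ℝ → ℝ) (τ : ℝ) (U₀ : H1 × L2) : ℕ → H1 × L2
  | 0 => U₀
  | n + 1 => correctedLieStep g τ (correctedLie g τ U₀ n)

end

end WaveTorus

/-!
The proof works in the characteristic variables `c_ε = ∂ₜu + ε ∂ₓu`, `ε = ±1`, in which everything is
explicit: with `T_s` the translation by `s`, the free group acts as `c_ε ↦ T_{εt} c_ε`
(`char_waveGroup`), and a solution satisfies
`c_ε(t + s) = T_{εs} c_ε(t) + ∫₀ˢ T_{ε(s-r)} g(u(t + r)) dr` (`char_duhamel`).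
One step of the scheme replaces `f(s) = T_{-εs} g(u(t + s))` in the integral over `[0, τ]` by
`f(0) + ∫₀ˢ T_{-2εr} (g'(u(t)) c_{-ε}(t)) dr` (`char_increment`).

Since `f'(s) = T_{-εs} (g'(u) c_{-ε})(t + s)`, the derivative of `g(u)` along one characteristic only
involves the other characteristic variable.  The latter is transported, so `T_{εs} c_{-ε}(t + s)`
equals `c_{-ε}(t)` up to `O(s)` in `L²`, after the common factor `T_{-2εs}` has been removed.  What
remains is the product of `c_{-ε}(t)` with the change `∫₀ˢ T_{εr} c_ε(t + r) dr` of the displacement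
along the characteristic.  For finite-energy solutions this product need not be `O(s)` in `L²` at a
single time.  It is bounded by `(τ A)^{1/2} ≤ (τ + A) / 2`, where `A` is the integral over the time
step of the squared product of two profiles moving in opposite directions
(`enorm_nonlinDeriv_sub_sq_le`).  By transversality of the two families of characteristics, these
integrals sum to a bounded quantity (`exists_overlap_le`, `exists_sum_overlap_le`).  Hence
the local errors `O(τ² (τ + A))` (`norm_char_local_error_le`) sum to `O(τ²)`.  The displacement itself
is needed only in `L²`, where the local error is of third order by Lipschitz continuity alone
(`norm_disp_local_error_le`).

One step is Lipschitz continuous on bounded sets of `H¹ × L²` with constant `1 + O(τ)`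
(`charNorm_correctedLieStep_sub_le`), and the numerical solution stays bounded as long as the error is
at most one, which closes a discrete Gronwall argument (`charNorm_error_le`).
-/

namespace WaveTorus

open MeasureTheory Set Filter
open scoped ContDiff RealInnerProductSpace ENNReal Topology

noncomputable section

/-! ### Translations, the Sobolev embedding, and curves of translates -/

theorem ae_shift {P : Torus → Prop} (h : ∀ᵐ x : Torus, P x) (y : Torus) :
    ∀ᵐ x : Torus, P (x + y) :=
  (measurePreserving_add_right (volume : Measure Torus) y).quasiMeasurePreserving.ae h

theorem translate_translate (s t : ℝ) (f : L2) :
    translate s (translate t f) = translate (s + t) f := by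
  apply Lp.ext
  filter_upwards [coeFn_translate s (translate t f), coeFn_translate (s + t) f,
    ae_shift (coeFn_translate t f) (s : Torus)] with x h1 h2 h3
  rw [h1, h2, h3, AddCircle.coe_add, add_assoc]

theorem norm_translate (t : ℝ) (f : L2) : ‖translate t f‖ = ‖f‖ := (translate t).norm_map f

theorem continuousOn_translate {X : Type*} [TopologicalSpace X] {S : Set X} {c : X → ℝ}
    {f : X → L2} (hc : ContinuousOn c S) (hf : ContinuousOn f S) :
    ContinuousOn (fun s => translate (c s) (f s)) S := by
  intro s hs
  have h1 : Tendsto (fun r => translate (c r) (f s)) (𝓝[S] s) (𝓝 (translate (c s) (f s))) :=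
    ((continuous_translate (f s)).tendsto (c s)).comp (hc s hs)
  have h2 : Tendsto (fun r => translate (c r) (f r - f s)) (𝓝[S] s) (𝓝 0) := by
    rw [tendsto_zero_iff_norm_tendsto_zero]
    simp only [norm_translate]
    exact tendsto_iff_norm_sub_tendsto_zero.1 (hf s hs)
  have := h2.add h1
  simp only [map_sub, sub_add_cancel, zero_add] at this
  exact this

theorem integrable_coe (f : L2) : Integrable f (volume : Measure Torus) :=
  (Lp.memLp f).integrable (by norm_num)

/-- A Bochner integral in `L²(𝕋)` is bounded almost everywhere by the integral of pointwise
bounds of the integrand.  Tested against `sign · 1_A`, this is Tonelli's theorem. -/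
theorem enorm_intervalIntegral_le {a b : ℝ} (hab : a ≤ b) {F : ℝ → L2}
    (hF : IntervalIntegrable F volume a b) {Φ : ℝ → Torus → ℝ≥0∞}
    (hΦ : Measurable (Function.uncurry Φ))
    (h : ∀ r ∈ Icc a b, ∀ᵐ x : Torus, ‖F r x‖ₑ ≤ Φ r x) :
    ∀ᵐ x : Torus, ‖(∫ r in a..b, F r) x‖ₑ ≤ ∫⁻ r in Ioc a b, Φ r x := by
  set w : L2 := ∫ r in a..b, F r with hw
  have hwm : Measurable w := (Lp.stronglyMeasurable w).measurable
  refine ae_le_of_forall_setLIntegral_le_of_sigmaFinite hwm.enorm fun A hA _ => ?_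
  set φ : Torus → ℝ := A.indicator fun x => w x / |w x| with hφ
  have hφm : Measurable φ := (hwm.div hwm.abs).indicator hA
  have hφb : ∀ x, ‖φ x‖ ≤ 1 := by
    intro x
    by_cases hx : x ∈ A
    · simp only [hφ, hx, indicator_of_mem, norm_div, Real.norm_eq_abs, abs_abs]
      exact div_self_le_one _
    · simp [hφ, hx]
  have hφL : MemLp φ 2 (volume : Measure Torus) :=
    MemLp.of_bound hφm.aestronglyMeasurable 1 (Eventually.of_forall hφb)
  have hin : ∀ f : L2, ⟪hφL.toLp φ, f⟫ = ∫ x, φ x * f x := by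
    intro f
    rw [L2.inner_def]
    refine integral_congr_ae ?_
    filter_upwards [hφL.coeFn_toLp] with x hx
    rw [hx]
    simp [mul_comm]
  have e1 : ∫⁻ x in A, ‖w x‖ₑ = ENNReal.ofReal ⟪hφL.toLp φ, w⟫ := by
    rw [← ofReal_integral_norm_eq_lintegral_enorm (integrable_coe w).integrableOn, hin,
      ← integral_indicator hA]
    congr 2
    funext x
    by_cases hx : x ∈ A
    · simp only [hφ, hx, indicator_of_mem, Real.norm_eq_abs]
      rcases eq_or_ne (w x) 0 with h0 | h0
      · simp [h0]
      · rw [div_mul_eq_mul_div, ← abs_mul_abs_self, mul_div_assoc, div_self (abs_ne_zero.2 h0),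
          mul_one]
    · simp [hφ, hx]
  have e2 : ⟪hφL.toLp φ, w⟫ = ∫ r in a..b, ⟪hφL.toLp φ, F r⟫ :=
    ((innerSL ℝ (hφL.toLp φ)).intervalIntegral_comp_comm hF).symm
  have e3 : ∀ r ∈ Ioc a b, ‖⟪hφL.toLp φ, F r⟫‖ₑ ≤ ∫⁻ x in A, Φ r x := by
    intro r hr
    rw [hin]
    refine (enorm_integral_le_lintegral_enorm _).trans ?_
    rw [← lintegral_indicator hA]
    refine lintegral_mono_ae ?_
    filter_upwards [h r ⟨hr.1.le, hr.2⟩] with x hx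
    rw [enorm_mul]
    by_cases hxA : x ∈ A
    · simp only [hxA, indicator_of_mem]
      calc ‖φ x‖ₑ * ‖F r x‖ₑ ≤ 1 * Φ r x := by
            gcongr
            rw [← ofReal_norm, ENNReal.ofReal_le_one]
            exact hφb x
        _ = Φ r x := one_mul _
    · simp [hφ, hxA]
  rw [e1, e2, intervalIntegral.integral_of_le hab]
  calc ENNReal.ofReal (∫ r in Ioc a b, ⟪hφL.toLp φ, F r⟫)
      ≤ ‖∫ r in Ioc a b, ⟪hφL.toLp φ, F r⟫‖ₑ := Real.ofReal_le_enorm _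
    _ ≤ ∫⁻ r in Ioc a b, ‖⟪hφL.toLp φ, F r⟫‖ₑ := enorm_integral_le_lintegral_enorm _
    _ ≤ ∫⁻ r in Ioc a b, ∫⁻ x in A, Φ r x := setLIntegral_mono' measurableSet_Ioc e3
    _ = ∫⁻ x in A, ∫⁻ r in Ioc a b, Φ r x := lintegral_lintegral_swap hΦ.aemeasurable

theorem lintegral_enorm_le (f : L2) :
    ∫⁻ x, ‖f x‖ₑ ≤ ENNReal.ofReal (√(2 * Real.pi) * ‖f‖) := by
  have h := eLpNorm_le_eLpNorm_mul_rpow_measure_univ (μ := (volume : Measure Torus))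
    (p := 1) (q := 2) (by norm_num) (Lp.stronglyMeasurable f).aestronglyMeasurable
  rw [eLpNorm_one_eq_lintegral_enorm] at h
  refine h.trans (le_of_eq ?_)
  rw [← Lp.enorm_def, AddCircle.measure_univ, ENNReal.ofReal_rpow_of_pos Real.two_pi_pos,
    ← ofReal_norm, ← ENNReal.ofReal_mul (norm_nonneg _), Real.sqrt_eq_rpow, mul_comm]
  norm_num

theorem measurable_comp_shift {X : Type*} [MeasurableSpace X] {Y : Type*} [MeasurableSpace Y]
    {P : Torus → Y} (hP : Measurable P) {a b : X → Torus} (ha : Measurable a) (hb : Measurable b) :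
    Measurable fun x => P (a x + b x) := hP.comp (ha.add hb)

theorem H1.norm_toL2_le (u : H1) : ‖H1.toL2 u‖ ≤ ‖u‖ := by
  have := H1.norm_sq u
  exact (sq_le_sq₀ (norm_nonneg _) (norm_nonneg _)).1 (by nlinarith [sq_nonneg ‖H1.deriv u‖])

theorem H1.norm_deriv_le (u : H1) : ‖H1.deriv u‖ ≤ ‖u‖ := by
  have := H1.norm_sq u
  exact (sq_le_sq₀ (norm_nonneg _) (norm_nonneg _)).1 (by nlinarith [sq_nonneg ‖H1.toL2 u‖])

theorem H1.norm_le (u : H1) : ‖u‖ ≤ ‖H1.toL2 u‖ + ‖H1.deriv u‖ := by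
  have := H1.norm_sq u
  refine (sq_le_sq₀ (norm_nonneg _) (by positivity)).1 ?_
  nlinarith [mul_nonneg (norm_nonneg (H1.toL2 u)) (norm_nonneg (H1.deriv u))]

/-- The Sobolev embedding `H¹(𝕋) ⊂ L^∞(𝕋)`.  Averaging `|f(x)| ≤ |f(x + t)| + ‖f'‖_{L¹}` over `t` gives the
constant `(2π)^{-1/2} + (2π)^{1/2} ≤ 4`. -/
theorem H1.abs_le (u : H1) : ∀ᵐ x : Torus, |H1.toL2 u x| ≤ 4 * ‖u‖ := by
  set f : L2 := H1.toL2 u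
  set f' : L2 := H1.deriv u
  have hu : IsWeakDeriv f f' := u.2
  have hfm : Measurable f := (Lp.stronglyMeasurable f).measurable
  have hfm' : Measurable f' := (Lp.stronglyMeasurable f').measurable
  have hcoe : Measurable (fun t : ℝ => (t : Torus)) := AddCircle.measurable_mk'
  -- `|f(x + t) - f(x)| ≤ ‖f'‖_{L¹}` for `t` in one period
  have key : ∀ t ∈ Ioc (0 : ℝ) (0 + 2 * Real.pi), ∀ᵐ x : Torus,
      ‖f x‖ₑ ≤ ‖f (x + (t : Torus))‖ₑ + ∫⁻ y, ‖f' y‖ₑ := by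
    intro t ht
    have h1 := enorm_intervalIntegral_le ht.1.le
      ((continuous_translate f').intervalIntegrable 0 t)
      (Φ := fun s x => ‖f' (x + (s : Torus))‖ₑ)
      (measurable_comp_shift hfm' measurable_snd (hcoe.comp measurable_fst)).enorm
      (fun s _ => by
        filter_upwards [coeFn_translate s f'] with x hx
        rw [hx])
    rw [← translate_sub_translate hu 0 t, translate_zero] at h1
    filter_upwards [h1, coeFn_translate t f, Lp.coeFn_sub (translate t f) f] with x h1 h2 h3
    rw [h3, Pi.sub_apply, h2] at h1
    have h4 : ∫⁻ s in Ioc 0 t, ‖f' (x + (s : Torus))‖ₑ ≤ ∫⁻ y, ‖f' y‖ₑ := by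
      calc ∫⁻ s in Ioc 0 t, ‖f' (x + (s : Torus))‖ₑ
          ≤ ∫⁻ s in Ioc 0 (0 + 2 * Real.pi), ‖f' (x + (s : Torus))‖ₑ :=
            lintegral_mono_set (Ioc_subset_Ioc_right ht.2)
        _ = ∫⁻ y, ‖f' (x + y)‖ₑ :=
            AddCircle.lintegral_preimage (2 * Real.pi) 0 (fun y => ‖f' (x + y)‖ₑ)
        _ = ∫⁻ y, ‖f' y‖ₑ := lintegral_add_left_eq_self (fun y => ‖f' y‖ₑ) x
    calc ‖f x‖ₑ = ‖f (x + (t : Torus)) - (f (x + (t : Torus)) - f x)‖ₑ := by rw [sub_sub_cancel]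
      _ ≤ ‖f (x + (t : Torus))‖ₑ + ‖f (x + (t : Torus)) - f x‖ₑ := enorm_sub_le
      _ ≤ _ := by gcongr; exact h1.trans h4
  have hset : MeasurableSet {q : ℝ × Torus |
      ‖f q.2‖ₑ ≤ ‖f (q.2 + (q.1 : Torus))‖ₑ + ∫⁻ y, ‖f' y‖ₑ} :=
    measurableSet_le (hfm.comp measurable_snd).enorm
      ((measurable_comp_shift hfm measurable_snd (hcoe.comp measurable_fst)).enorm.add_const _)
  have key2 : ∀ᵐ (t : ℝ) ∂((volume : Measure ℝ).restrict (Ioc 0 (0 + 2 * Real.pi))), ∀ᵐ x : Torus,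
      ‖f x‖ₑ ≤ ‖f (x + (t : Torus))‖ₑ + ∫⁻ y, ‖f' y‖ₑ :=
    (ae_restrict_iff' measurableSet_Ioc).2 (Eventually.of_forall key)
  have key3 := (Measure.ae_ae_comm (μ := (volume : Measure ℝ).restrict (Ioc 0 (0 + 2 * Real.pi)))
    (ν := (volume : Measure Torus)) hset).1 key2
  filter_upwards [key3] with x hx
  have h5 := lintegral_mono_ae hx
  rw [lintegral_const, lintegral_add_right _ measurable_const, lintegral_const,
    AddCircle.lintegral_preimage (2 * Real.pi) 0 (fun y => ‖f (x + y)‖ₑ),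
    lintegral_add_left_eq_self (fun y => ‖f y‖ₑ) x, Measure.restrict_apply_univ, Real.volume_Ioc,
    zero_add, sub_zero] at h5
  have h6 := h5.trans (add_le_add (lintegral_enorm_le f)
    (mul_le_mul_left (lintegral_enorm_le f') _))
  have hpi := Real.pi_gt_three
  have hpi2 := Real.pi_lt_d2
  rw [← ofReal_norm, ← ENNReal.ofReal_mul (norm_nonneg _),
    ← ENNReal.ofReal_mul (by positivity), ← ENNReal.ofReal_add (by positivity) (by positivity),
    ENNReal.ofReal_le_ofReal_iff (by positivity), Real.norm_eq_abs] at h6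
  have hf : ‖f‖ ≤ ‖u‖ := H1.norm_toL2_le u
  have hf' : ‖f'‖ ≤ ‖u‖ := H1.norm_deriv_le u
  have hs : √(2 * Real.pi) ≤ 3 := Real.sqrt_le_iff.2 ⟨by norm_num, by linarith⟩
  have hs0 := Real.sqrt_nonneg (2 * Real.pi)
  have hb : ∀ c : ℝ, 0 ≤ c → c ≤ ‖u‖ → √(2 * Real.pi) * c ≤ 3 * ‖u‖ := fun c h0 h1 =>
    mul_le_mul hs h1 h0 (by norm_num)
  have h7 := hb _ (norm_nonneg f) hf
  have h8 := mul_le_mul_of_nonneg_right (hb _ (norm_nonneg f') hf') Real.two_pi_pos.le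
  have h9 : (2 * Real.pi) * |f x| ≤ (2 * Real.pi) * (4 * ‖u‖) := by
    nlinarith [norm_nonneg u]
  exact le_of_mul_le_mul_left h9 Real.two_pi_pos

/-- Translation on `H¹(𝕋)`. -/
def translateH1 (t : ℝ) (u : H1) : H1 :=
  ⟨WithLp.toLp 2 (translate t (H1.toL2 u), translate t (H1.deriv u)), IsWeakDeriv.translate u.2 t⟩

theorem toL2_translateH1 (t : ℝ) (u : H1) :
    H1.toL2 (translateH1 t u) = translate t (H1.toL2 u) := rfl

theorem deriv_translateH1 (t : ℝ) (u : H1) :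
    H1.deriv (translateH1 t u) = translate t (H1.deriv u) := rfl

theorem norm_translateH1 (t : ℝ) (u : H1) : ‖translateH1 t u‖ = ‖u‖ := by
  refine (sq_eq_sq₀ (norm_nonneg _) (norm_nonneg _)).1 ?_
  rw [H1.norm_sq, H1.norm_sq, toL2_translateH1, deriv_translateH1, norm_translate, norm_translate]

theorem H1.ext {u w : H1} (h : H1.toL2 u = H1.toL2 w) (h' : H1.deriv u = H1.deriv w) : u = w :=
  Subtype.ext (WithLp.ofLp_injective 2 (Prod.ext h h'))

theorem H1.continuousOn_of {X : Type*} [TopologicalSpace X] {S : Set X} {u : X → H1}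
    (h : ContinuousOn (fun x => H1.toL2 (u x)) S) (h' : ContinuousOn (fun x => H1.deriv (u x)) S) :
    ContinuousOn u S := by
  rw [continuousOn_iff_continuous_domRestrict] at *
  exact Continuous.subtype_mk ((WithLp.prod_continuous_toLp 2 L2 L2).comp (h.prodMk h')) _

theorem continuousOn_translateH1 {X : Type*} [TopologicalSpace X] {S : Set X} {c : X → ℝ}
    {u : X → H1} (hc : ContinuousOn c S) (hu : ContinuousOn u S) :
    ContinuousOn (fun s => translateH1 (c s) (u s)) S :=
  H1.continuousOn_of
    (continuousOn_translate hc (H1.toL2.continuous.comp_continuousOn hu))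
    (continuousOn_translate hc (H1.deriv.continuous.comp_continuousOn hu))

/-- Product rule for `s ↦ T_{σ s} x(s)`; the curve `x` need only take values in `H¹(𝕋)` at the
point of differentiation. -/
theorem hasDerivWithinAt_translate_curve {x : ℝ → L2} {x' d : L2} {S : Set ℝ} {s : ℝ} (σ : ℝ)
    (hx : HasDerivWithinAt x x' S s) (hd : IsWeakDeriv (x s) d) :
    HasDerivWithinAt (fun r => translate (σ * r) (x r)) (translate (σ * s) (x' + σ • d)) S s := by
  have h1 : HasDerivWithinAt (fun r => translate (σ * r) (x s)) (σ • translate (σ * s) d) S s :=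
    ((hasDerivAt_translate hd (σ * s)).scomp s
      (by simpa using (hasDerivAt_id s).const_mul σ)).hasDerivWithinAt
  have h2 : HasDerivWithinAt (fun r => translate (σ * r) (x r - x s)) (translate (σ * s) x') S s := by
    rw [hasDerivWithinAt_iff_isLittleO] at hx ⊢
    have h3 : (fun r => translate (σ * r) (x r - x s - (r - s) • x')) =o[𝓝[S] s]
        fun r => r - s := by
      rw [← Asymptotics.isLittleO_norm_left]
      simp only [norm_translate]
      exact hx.norm_left
    have h4 : (fun r => (r - s) • (translate (σ * r) x' - translate (σ * s) x')) =o[𝓝[S] s]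
        fun r => r - s := by
      have : Tendsto (fun r => translate (σ * r) x' - translate (σ * s) x') (𝓝[S] s) (𝓝 0) := by
        have hc : Continuous fun r => translate (σ * r) x' - translate (σ * s) x' :=
          ((continuous_translate x').comp (continuous_const_mul σ)).sub continuous_const
        have := (hc.tendsto s).mono_left (nhdsWithin_le_nhds (s := S))
        simpa using this
      have h5 := (Asymptotics.isBigO_refl (fun r : ℝ => r - s) (𝓝[S] s)).smul_isLittleO
        ((Asymptotics.isLittleO_one_iff ℝ).2 this)
      simpa using h5
    refine (h3.add h4).congr_left fun r => ?_
    simp only [map_sub, map_smul, sub_self, map_zero]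
    module
  have := h2.add h1
  refine (this.congr_deriv ?_).congr (fun r _ => ?_) ?_
  · simp only [map_add, map_smul]
  · simp
  · simp

/-! ### The nonlinearity and its chain rule -/

/-- Bounds with a single constant `L` for a function `g` of class `C²` and its derivative on the
interval `[-K, K]`: size, Lipschitz constants, and first-order Taylor remainder. -/
structure C2Bound (g : ℝ → ℝ) (K L : ℝ) : Prop where
  nonneg : 0 ≤ L
  abs_le : ∀ a, |a| ≤ K → |g a| ≤ L
  abs_deriv_le : ∀ a, |a| ≤ K → |deriv g a| ≤ L
  lipschitz : ∀ a b, |a| ≤ K → |b| ≤ K → |g a - g b| ≤ L * |a - b|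
  lipschitz_deriv : ∀ a b, |a| ≤ K → |b| ≤ K → |deriv g a - deriv g b| ≤ L * |a - b|
  taylor : ∀ a b, |a| ≤ K → |b| ≤ K → |g b - g a - deriv g a * (b - a)| ≤ L * |b - a| * |b - a|

theorem exists_c2Bound {g : ℝ → ℝ} (hg : ContDiff ℝ 2 g) (K : ℝ) : ∃ L, C2Bound g K L := by
  have hd : ContDiff ℝ 1 (deriv g) :=
    ((contDiff_succ_iff_deriv (n := 1) (f := g)).1 (by simpa [one_add_one_eq_two] using hg)).2.2
  have hd2 : Continuous (deriv (deriv g)) := hd.continuous_deriv le_rfl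
  have hgd : Differentiable ℝ g := hg.differentiable (by norm_num)
  have hgd' : Differentiable ℝ (deriv g) := hd.differentiable (by norm_num)
  obtain ⟨A, hA⟩ := (isCompact_Icc (a := -K) (b := K)).exists_bound_of_continuousOn
    hg.continuous.continuousOn
  obtain ⟨B, hB⟩ := (isCompact_Icc (a := -K) (b := K)).exists_bound_of_continuousOn
    hd.continuous.continuousOn
  obtain ⟨D, hD⟩ := (isCompact_Icc (a := -K) (b := K)).exists_bound_of_continuousOn
    hd2.continuousOn
  have hAL : A ≤ |A| + |B| + |D| := by linarith [le_abs_self A, abs_nonneg B, abs_nonneg D]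
  have hBL : B ≤ |A| + |B| + |D| := by linarith [le_abs_self B, abs_nonneg A, abs_nonneg D]
  have hDL : D ≤ |A| + |B| + |D| := by linarith [le_abs_self D, abs_nonneg B, abs_nonneg A]
  set L := |A| + |B| + |D|
  have hL : 0 ≤ L := by positivity
  have hlip : ∀ a b, |a| ≤ K → |b| ≤ K → |deriv g a - deriv g b| ≤ L * |a - b| := fun a b ha hb =>
    (convex_Icc (-K) K).norm_image_sub_le_of_norm_deriv_le (fun x _ => hgd' x)
      (fun x hx => (hD x hx).trans hDL) (abs_le.1 hb) (abs_le.1 ha)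
  refine ⟨L, hL, fun a ha => (hA a (abs_le.1 ha)).trans hAL,
    fun a ha => (hB a (abs_le.1 ha)).trans hBL, fun a b ha hb => ?_, hlip, fun a b ha hb => ?_⟩
  · exact (convex_Icc (-K) K).norm_image_sub_le_of_norm_deriv_le (fun x _ => hgd x)
      (fun x hx => (hB x hx).trans hBL) (abs_le.1 hb) (abs_le.1 ha)
  · have h := (convex_uIcc a b).norm_image_sub_le_of_norm_hasDerivWithin_le
      (f := fun x => g x - deriv g a * x) (f' := fun x => deriv g x - deriv g a * 1)
      (C := L * |b - a|)
      (fun x _ => ((hgd x).hasDerivAt.sub ((hasDerivAt_id x).const_mul _)).hasDerivWithinAt)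
      (fun x hx => by
        have hx' : x ∈ Icc (-K) K :=
          (convex_Icc (-K) K).ordConnected.uIcc_subset (abs_le.1 ha) (abs_le.1 hb) hx
        rw [mul_one]
        refine (hlip x a (abs_le.2 hx') ha).trans (mul_le_mul_of_nonneg_left ?_ hL)
        exact abs_sub_left_of_mem_uIcc hx)
      left_mem_uIcc right_mem_uIcc
    rw [Real.norm_eq_abs, Real.norm_eq_abs] at h
    refine le_trans (le_of_eq ?_) h
    congr 1
    ring

theorem coeFn_classL2 {f : Torus → ℝ} (h : MemLp f 2 (volume : Measure Torus)) :
    classL2 f =ᵐ[volume] f := by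
  rw [classL2, dif_pos h]
  exact h.coeFn_toLp

section Nemytskii

variable {g : ℝ → ℝ}

theorem H1.abs_le_of_norm_le {R : ℝ} {u : H1} (hu : ‖u‖ ≤ R) :
    ∀ᵐ x : Torus, |H1.toL2 u x| ≤ 4 * R := by
  filter_upwards [H1.abs_le u] with x hx
  linarith

theorem aestronglyMeasurable_comp {h : ℝ → ℝ} (hh : Continuous h) (f : L2) :
    AEStronglyMeasurable (fun x => h (f x)) (volume : Measure Torus) :=
  (hh.comp_stronglyMeasurable (Lp.stronglyMeasurable f)).aestronglyMeasurable

theorem memLp_comp {h : ℝ → ℝ} (hh : Continuous h) (u : H1) :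
    MemLp (fun x => h (H1.toL2 u x)) ∞ (volume : Measure Torus) := by
  obtain ⟨A, hA⟩ := (isCompact_Icc (a := -(4 * ‖u‖)) (b := 4 * ‖u‖)).exists_bound_of_continuousOn
    hh.continuousOn
  refine memLp_top_of_bound (aestronglyMeasurable_comp hh _) A ?_
  filter_upwards [H1.abs_le u] with x hx
  exact hA _ (_root_.abs_le.1 hx)

theorem coeFn_nonlin (hg : ContDiff ℝ 2 g) (u : H1) :
    nonlin g u =ᵐ[volume] fun x => g (H1.toL2 u x) :=
  coeFn_classL2 ((memLp_comp hg.continuous u).mono_exponent le_top)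

theorem coeFn_nonlinDeriv (hg : ContDiff ℝ 2 g) (u : H1) (v : L2) :
    nonlinDeriv g u v =ᵐ[volume] fun x => deriv g (H1.toL2 u x) * v x :=
  coeFn_classL2 ((Lp.memLp v).mul (memLp_comp (hg.continuous_deriv (by norm_num)) u))

theorem nonlinDeriv_add (hg : ContDiff ℝ 2 g) (u : H1) (v w : L2) :
    nonlinDeriv g u (v + w) = nonlinDeriv g u v + nonlinDeriv g u w := by
  apply Lp.ext
  filter_upwards [coeFn_nonlinDeriv hg u v, coeFn_nonlinDeriv hg u w,
    coeFn_nonlinDeriv hg u (v + w), Lp.coeFn_add v w,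
    Lp.coeFn_add (nonlinDeriv g u v) (nonlinDeriv g u w)] with x h1 h2 h3 h4 h5
  rw [h3, h5, Pi.add_apply, h1, h2, h4, Pi.add_apply, mul_add]

theorem nonlinDeriv_smul (hg : ContDiff ℝ 2 g) (u : H1) (c : ℝ) (v : L2) :
    nonlinDeriv g u (c • v) = c • nonlinDeriv g u v := by
  apply Lp.ext
  filter_upwards [coeFn_nonlinDeriv hg u v, coeFn_nonlinDeriv hg u (c • v), Lp.coeFn_smul c v,
    Lp.coeFn_smul c (nonlinDeriv g u v)] with x h1 h2 h3 h4
  rw [h2, h4, Pi.smul_apply, h1, h3, Pi.smul_apply, smul_eq_mul, smul_eq_mul]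
  ring

theorem nonlinDeriv_sub (hg : ContDiff ℝ 2 g) (u : H1) (v w : L2) :
    nonlinDeriv g u (v - w) = nonlinDeriv g u v - nonlinDeriv g u w := by
  rw [eq_sub_iff_add_eq, ← nonlinDeriv_add hg, sub_add_cancel]

theorem translate_nonlin (hg : ContDiff ℝ 2 g) (t : ℝ) (u : H1) :
    translate t (nonlin g u) = nonlin g (translateH1 t u) := by
  apply Lp.ext
  filter_upwards [coeFn_translate t (nonlin g u), ae_shift (coeFn_nonlin hg u) (t : Torus),
    coeFn_nonlin hg (translateH1 t u), coeFn_translate t (H1.toL2 u)] with x h1 h2 h3 h4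
  rw [h1, h2, h3, toL2_translateH1, h4]

theorem translate_nonlinDeriv (hg : ContDiff ℝ 2 g) (t : ℝ) (u : H1) (v : L2) :
    translate t (nonlinDeriv g u v) = nonlinDeriv g (translateH1 t u) (translate t v) := by
  apply Lp.ext
  filter_upwards [coeFn_translate t (nonlinDeriv g u v),
    ae_shift (coeFn_nonlinDeriv hg u v) (t : Torus),
    coeFn_nonlinDeriv hg (translateH1 t u) (translate t v), coeFn_translate t (H1.toL2 u),
    coeFn_translate t v] with x h1 h2 h3 h4 h5
  rw [h1, h2, h3, toL2_translateH1, h4, h5]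

variable {R L : ℝ}

theorem abs_nonlin_le (hg : ContDiff ℝ 2 g) (hB : C2Bound g (4 * R) L) {u : H1} (hu : ‖u‖ ≤ R) :
    ∀ᵐ x : Torus, |nonlin g u x| ≤ L := by
  filter_upwards [coeFn_nonlin hg u, H1.abs_le_of_norm_le hu] with x h1 h2
  rw [h1]
  exact hB.abs_le _ h2

theorem norm_le_of_abs_le {f : L2} {c : ℝ} (hc : 0 ≤ c) (h : ∀ᵐ x : Torus, |f x| ≤ c) :
    ‖f‖ ≤ 3 * c := by
  have h1 := Lp.norm_le_of_ae_bound (f := f) hc h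
  refine h1.trans (mul_le_mul_of_nonneg_right ?_ hc)
  have e : ((measureUnivNNReal (volume : Measure Torus) : NNReal) : ℝ) = 2 * Real.pi := by
    rw [measureUnivNNReal, ENNReal.coe_toNNReal_eq_toReal, AddCircle.measure_univ,
      ENNReal.toReal_ofReal Real.two_pi_pos.le]
  rw [e, ENNReal.toReal_ofNat, ← one_div, ← Real.sqrt_eq_rpow]
  exact Real.sqrt_le_iff.2 ⟨by norm_num, by linarith [Real.pi_lt_d2]⟩

theorem norm_nonlin_le (hg : ContDiff ℝ 2 g) (hB : C2Bound g (4 * R) L) {u : H1} (hu : ‖u‖ ≤ R) :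
    ‖nonlin g u‖ ≤ 3 * L := norm_le_of_abs_le hB.nonneg (abs_nonlin_le hg hB hu)

theorem norm_nonlin_sub_le (hg : ContDiff ℝ 2 g) (hB : C2Bound g (4 * R) L) {u w : H1}
    (hu : ‖u‖ ≤ R) (hw : ‖w‖ ≤ R) :
    ‖nonlin g u - nonlin g w‖ ≤ L * ‖H1.toL2 u - H1.toL2 w‖ := by
  refine Lp.norm_le_mul_norm_of_ae_le_mul ?_
  filter_upwards [coeFn_nonlin hg u, coeFn_nonlin hg w, H1.abs_le_of_norm_le hu,
    H1.abs_le_of_norm_le hw, Lp.coeFn_sub (nonlin g u) (nonlin g w),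
    Lp.coeFn_sub (H1.toL2 u) (H1.toL2 w)] with x h1 h2 h3 h4 h5 h6
  rw [h5, h6, Pi.sub_apply, Pi.sub_apply, h1, h2]
  exact hB.lipschitz _ _ h3 h4

theorem norm_nonlinDeriv_le (hg : ContDiff ℝ 2 g) (hB : C2Bound g (4 * R) L) {u : H1}
    (hu : ‖u‖ ≤ R) (v : L2) : ‖nonlinDeriv g u v‖ ≤ L * ‖v‖ := by
  refine Lp.norm_le_mul_norm_of_ae_le_mul ?_
  filter_upwards [coeFn_nonlinDeriv hg u v, H1.abs_le_of_norm_le hu] with x h1 h3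
  rw [h1, norm_mul]
  exact mul_le_mul_of_nonneg_right (hB.abs_deriv_le _ h3) (norm_nonneg _)

theorem abs_nonlinDeriv_sub_le (hg : ContDiff ℝ 2 g) (hB : C2Bound g (4 * R) L) {u w : H1}
    (hu : ‖u‖ ≤ R) (hw : ‖w‖ ≤ R) (v : L2) :
    ∀ᵐ x : Torus, |(nonlinDeriv g u v - nonlinDeriv g w v : L2) x|
      ≤ L * |(H1.toL2 u - H1.toL2 w : L2) x| * |v x| := by
  filter_upwards [coeFn_nonlinDeriv hg u v, coeFn_nonlinDeriv hg w v, H1.abs_le_of_norm_le hu,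
    H1.abs_le_of_norm_le hw, Lp.coeFn_sub (nonlinDeriv g u v) (nonlinDeriv g w v),
    Lp.coeFn_sub (H1.toL2 u) (H1.toL2 w)] with x h1 h2 h3 h4 h5 h6
  rw [h5, h6, Pi.sub_apply, Pi.sub_apply, h1, h2, ← sub_mul, abs_mul]
  exact mul_le_mul_of_nonneg_right (hB.lipschitz_deriv _ _ h3 h4) (abs_nonneg _)

theorem norm_nonlinDeriv_sub_le (hg : ContDiff ℝ 2 g) (hB : C2Bound g (4 * R) L) {u w : H1}
    (hu : ‖u‖ ≤ R) (hw : ‖w‖ ≤ R) (v : L2) :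
    ‖nonlinDeriv g u v - nonlinDeriv g w v‖ ≤ L * (4 * ‖u - w‖) * ‖v‖ := by
  refine Lp.norm_le_mul_norm_of_ae_le_mul ?_
  filter_upwards [abs_nonlinDeriv_sub_le hg hB hu hw v, H1.abs_le (u - w)] with x h1 h2
  rw [map_sub] at h2
  exact h1.trans (mul_le_mul_of_nonneg_right (mul_le_mul_of_nonneg_left h2 hB.nonneg)
    (abs_nonneg _))

theorem norm_nonlin_taylor_le (hg : ContDiff ℝ 2 g) (hB : C2Bound g (4 * R) L) {u w : H1}
    (hu : ‖u‖ ≤ R) (hw : ‖w‖ ≤ R) :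
    ‖nonlin g w - nonlin g u - nonlinDeriv g u (H1.toL2 w - H1.toL2 u)‖
      ≤ L * (4 * ‖w - u‖) * ‖H1.toL2 w - H1.toL2 u‖ := by
  refine Lp.norm_le_mul_norm_of_ae_le_mul ?_
  filter_upwards [coeFn_nonlin hg u, coeFn_nonlin hg w, H1.abs_le_of_norm_le hu,
    H1.abs_le_of_norm_le hw, Lp.coeFn_sub (nonlin g w) (nonlin g u),
    Lp.coeFn_sub (H1.toL2 w) (H1.toL2 u),
    Lp.coeFn_sub (nonlin g w - nonlin g u) (nonlinDeriv g u (H1.toL2 w - H1.toL2 u)),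
    coeFn_nonlinDeriv hg u (H1.toL2 w - H1.toL2 u),
    H1.abs_le (w - u)] with x h1 h2 h3 h4 h5 h6 h7 h8 h9
  rw [map_sub, h6, Pi.sub_apply] at h9
  rw [h7, Pi.sub_apply, h5, h8, h6, Pi.sub_apply, Pi.sub_apply, h1, h2]
  exact (hB.taylor _ _ h3 h4).trans (mul_le_mul_of_nonneg_right
    (mul_le_mul_of_nonneg_left h9 hB.nonneg) (abs_nonneg _))

theorem continuous_nonlin (hg : ContDiff ℝ 2 g) : Continuous (nonlin g) := by
  rw [continuous_iff_continuousAt]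
  intro u
  obtain ⟨L, hB⟩ := exists_c2Bound hg (4 * (‖u‖ + 1))
  rw [ContinuousAt, tendsto_iff_norm_sub_tendsto_zero]
  have h1 : Tendsto (fun w => L * ‖H1.toL2 w - H1.toL2 u‖) (𝓝 u) (𝓝 0) := by
    have h : Continuous fun w => L * ‖H1.toL2 w - H1.toL2 u‖ := by fun_prop
    simpa using h.tendsto u
  refine squeeze_zero' (Eventually.of_forall fun _ => norm_nonneg _) ?_ h1
  filter_upwards [(continuous_norm (E := H1)).continuousAt.eventually_lt continuousAt_const
    (lt_add_one ‖u‖)] with w hw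
  exact norm_nonlin_sub_le hg hB hw.le (lt_add_one _).le

/-- Chain rule in `L²(𝕋)` along a curve that is continuous in `H¹(𝕋)` and differentiable in
`L²(𝕋)`: the Taylor remainder is the product of an `L^∞` norm that tends to `0` and an `L²` norm
of first order. -/
theorem hasDerivWithinAt_nonlin (hg : ContDiff ℝ 2 g) {U : ℝ → H1} {S : Set ℝ} {s : ℝ} {y' : L2}
    (hU : ContinuousWithinAt U S s) (hd : HasDerivWithinAt (fun r => H1.toL2 (U r)) y' S s) :
    HasDerivWithinAt (fun r => nonlin g (U r)) (nonlinDeriv g (U s) y') S s := by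
  obtain ⟨L, hB⟩ := exists_c2Bound hg (4 * (‖U s‖ + 1))
  have hs : ‖U s‖ ≤ ‖U s‖ + 1 := (lt_add_one _).le
  have hO : (fun r => H1.toL2 (U r) - H1.toL2 (U s)) =O[𝓝[S] s] fun r => r - s :=
    hd.hasFDerivWithinAt.isBigO_sub
  rw [hasDerivWithinAt_iff_isLittleO] at hd ⊢
  have h0 : Tendsto (fun r => L * (4 * ‖U r - U s‖)) (𝓝[S] s) (𝓝 0) := by
    have := tendsto_iff_norm_sub_tendsto_zero.1 hU
    simpa using (this.const_mul 4).const_mul L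
  have h1 : (fun r => nonlin g (U r) - nonlin g (U s)
      - nonlinDeriv g (U s) (H1.toL2 (U r) - H1.toL2 (U s))) =o[𝓝[S] s] fun r => r - s := by
    have h2 : (fun r => (L * (4 * ‖U r - U s‖)) • (H1.toL2 (U r) - H1.toL2 (U s)))
        =o[𝓝[S] s] fun r => r - s := by
      simpa using ((Asymptotics.isLittleO_one_iff ℝ).2 h0).smul_isBigO hO
    refine Asymptotics.IsBigO.trans_isLittleO (Asymptotics.IsBigO.of_bound 1 ?_) h2
    filter_upwards [hU.norm.eventually_lt tendsto_const_nhds (lt_add_one ‖U s‖)] with r hr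
    rw [one_mul, norm_smul, Real.norm_of_nonneg (by have := hB.nonneg; positivity)]
    exact norm_nonlin_taylor_le hg hB hs hr.le
  have h3 : (fun r => nonlinDeriv g (U s) (H1.toL2 (U r) - H1.toL2 (U s) - (r - s) • y'))
      =o[𝓝[S] s] fun r => r - s :=
    Asymptotics.IsBigO.trans_isLittleO (Asymptotics.IsBigO.of_bound L
      (Eventually.of_forall fun r => norm_nonlinDeriv_le hg hB hs _)) hd
  refine (h1.add h3).congr_left fun r => ?_
  rw [nonlinDeriv_sub hg (U s) (H1.toL2 (U r) - H1.toL2 (U s)), nonlinDeriv_smul hg]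
  abel

theorem isWeakDeriv_of_hasDerivAt_translate {f f' : L2}
    (h : HasDerivAt (fun s => translate s f) f' 0) : IsWeakDeriv f f' := by
  intro φ hφ
  have h1 := hasDerivAt_integral_translate f hφ 0
  have h2 : HasDerivAt (fun s => ⟪hφ.memLp.toLp φ, translate s f⟫) ⟪hφ.memLp.toLp φ, f'⟫ 0 :=
    (innerSL ℝ (hφ.memLp.toLp φ)).hasFDerivAt.comp_hasDerivAt 0 h
  simp only [inner_toLp _ hφ] at h2
  have := h1.unique h2
  rw [translate_zero] at this
  linarith

/-- The chain rule `∂ₓ g(u) = g'(u) ∂ₓ u`, from the chain rule along the curve of translates. -/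
theorem isWeakDeriv_nonlin (hg : ContDiff ℝ 2 g) (u : H1) :
    IsWeakDeriv (nonlin g u) (nonlinDeriv g u (H1.deriv u)) := by
  apply isWeakDeriv_of_hasDerivAt_translate
  simp only [translate_nonlin hg]
  have hc : ContinuousOn (fun t => translateH1 t u) univ :=
    continuousOn_translateH1 continuousOn_id continuousOn_const
  have hd : HasDerivWithinAt (fun t => H1.toL2 (translateH1 t u)) (translate 0 (H1.deriv u))
      univ 0 := (hasDerivAt_translate u.2 0).hasDerivWithinAt
  have h := hasDerivWithinAt_nonlin hg (hc 0 (mem_univ _)) hd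
  have e : translateH1 0 u = u := H1.ext (translate_zero _) (translate_zero _)
  rw [translate_zero, e] at h
  exact hasDerivWithinAt_univ.1 h

theorem toL2_nonlinH1 (hg : ContDiff ℝ 2 g) (u : H1) : H1.toL2 (nonlinH1 g u) = nonlin g u := by
  have hex : ∃ w : H1, H1.toL2 w =ᵐ[volume] fun x => g (H1.toL2 u x) :=
    ⟨⟨WithLp.toLp 2 (nonlin g u, nonlinDeriv g u (H1.deriv u)), isWeakDeriv_nonlin hg u⟩,
      coeFn_nonlin hg u⟩
  apply Lp.ext
  rw [nonlinH1, dif_pos hex]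
  exact hex.choose_spec.trans (coeFn_nonlin hg u).symm

theorem IsWeakDeriv.unique {f f₁ f₂ : L2} (h₁ : IsWeakDeriv f f₁) (h₂ : IsWeakDeriv f f₂) :
    f₁ = f₂ := by
  have := (hasDerivAt_translate h₁ 0).unique (hasDerivAt_translate h₂ 0)
  rwa [translate_zero, translate_zero] at this

theorem deriv_nonlinH1 (hg : ContDiff ℝ 2 g) (u : H1) :
    H1.deriv (nonlinH1 g u) = nonlinDeriv g u (H1.deriv u) := by
  have h : IsWeakDeriv (H1.toL2 (nonlinH1 g u)) (H1.deriv (nonlinH1 g u)) := (nonlinH1 g u).2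
  rw [toL2_nonlinH1 hg] at h
  exact h.unique (isWeakDeriv_nonlin hg u)

end Nemytskii

/-! ### Characteristic variables and Lipschitz continuity of one step -/

/-- The displacement component of a state, as an element of `L²(𝕋)`. -/
def disp : H1 × L2 →L[ℝ] L2 := H1.toL2.comp (ContinuousLinearMap.fst ℝ H1 L2)

/-- The characteristic variable `φ₁ + ε ∂ₓ φ₀` of a state `(φ₀, φ₁)`.  For `ε = 1` and `ε = -1` these
are the Riemann invariants of the wave equation: the free evolution translates them to the left
and to the right, respectively. -/
def char (ε : ℝ) : H1 × L2 →L[ℝ] L2 :=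
  ContinuousLinearMap.snd ℝ H1 L2 + ε • H1.deriv.comp (ContinuousLinearMap.fst ℝ H1 L2)

theorem disp_apply (W : H1 × L2) : disp W = H1.toL2 W.1 := rfl

theorem char_apply (ε : ℝ) (W : H1 × L2) : char ε W = W.2 + ε • H1.deriv W.1 := rfl

theorem snd_eq_char (W : H1 × L2) : W.2 = (1 / 2 : ℝ) • (char 1 W + char (-1) W) := by
  rw [char_apply, char_apply]
  module

theorem deriv_fst_eq_char (W : H1 × L2) :
    H1.deriv W.1 = (1 / 2 : ℝ) • (char 1 W - char (-1) W) := by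
  rw [char_apply, char_apply]
  module

theorem norm_snd_le_char (W : H1 × L2) :
    ‖W.2‖ ≤ 1 / 2 * (‖char 1 W‖ + ‖char (-1) W‖) := by
  rw [snd_eq_char W, norm_smul, Real.norm_of_nonneg (by norm_num)]
  exact mul_le_mul_of_nonneg_left (norm_add_le _ _) (by norm_num)

/-- A norm on `H¹ × L²` in terms of the displacement and the characteristic variables. -/
def charNorm (W : H1 × L2) : ℝ := ‖disp W‖ + ‖char 1 W‖ + ‖char (-1) W‖

theorem charNorm_nonneg (W : H1 × L2) : 0 ≤ charNorm W := by unfold charNorm; positivity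

theorem charNorm_add_le (V W : H1 × L2) : charNorm (V + W) ≤ charNorm V + charNorm W := by
  simp only [charNorm, map_add]
  linarith [norm_add_le (disp V) (disp W), norm_add_le (char 1 V) (char 1 W),
    norm_add_le (char (-1) V) (char (-1) W)]

theorem norm_fst_le_charNorm (W : H1 × L2) : ‖W.1‖ ≤ charNorm W := by
  refine (H1.norm_le W.1).trans ?_
  have h : ‖H1.deriv W.1‖ ≤ 1 / 2 * (‖char 1 W‖ + ‖char (-1) W‖) := by
    rw [deriv_fst_eq_char W, norm_smul, Real.norm_of_nonneg (by norm_num)]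
    exact mul_le_mul_of_nonneg_left (norm_sub_le _ _) (by norm_num)
  have h1 := norm_nonneg (char 1 W)
  have h2 := norm_nonneg (char (-1) W)
  rw [charNorm, disp_apply]
  linarith

theorem norm_snd_le_charNorm (W : H1 × L2) : ‖W.2‖ ≤ charNorm W := by
  have h := norm_snd_le_char W
  have h0 := norm_nonneg (disp W)
  have h1 := norm_nonneg (char 1 W)
  have h2 := norm_nonneg (char (-1) W)
  rw [charNorm]
  linarith

theorem norm_char_le {ε : ℝ} (hε : ε = 1 ∨ ε = -1) (W : H1 × L2) :
    ‖char ε W‖ ≤ ‖W.1‖ + ‖W.2‖ := by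
  have h1 : ‖ε • H1.deriv W.1‖ = ‖H1.deriv W.1‖ := by
    rcases hε with rfl | rfl <;> simp
  rw [char_apply]
  linarith [norm_add_le W.2 (ε • H1.deriv W.1), H1.norm_deriv_le W.1]

theorem norm_char_le_charNorm {ε : ℝ} (hε : ε = 1 ∨ ε = -1) (W : H1 × L2) :
    ‖char ε W‖ ≤ charNorm W := by
  have h0 := norm_nonneg (disp W)
  have h1 := norm_nonneg (char 1 W)
  have h2 := norm_nonneg (char (-1) W)
  rw [charNorm]
  rcases hε with rfl | rfl <;> linarith

section Group

theorem disp_waveGroup (t : ℝ) (W : H1 × L2) : disp (waveGroup t W) =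
    (1 / 2 : ℝ) • (translate t (disp W) + translate (-t) (disp W)
      + ∫ s in (-t)..t, translate s W.2) := rfl

theorem char_waveGroup {ε : ℝ} (hε : ε = 1 ∨ ε = -1) (t : ℝ) (W : H1 × L2) :
    char ε (waveGroup t W) = translate (ε * t) (char ε W) := by
  have e2 : H1.deriv (waveGroup t W).1 = (1 / 2 : ℝ) • (translate t (H1.deriv W.1)
      + translate (-t) (H1.deriv W.1) + (translate t W.2 - translate (-t) W.2)) := rfl
  have e3 : (waveGroup t W).2 = (1 / 2 : ℝ) • (translate t (H1.deriv W.1)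
      - translate (-t) (H1.deriv W.1) + (translate t W.2 + translate (-t) W.2)) := rfl
  rw [char_apply, char_apply, e2, e3]
  rcases hε with rfl | rfl
  · rw [one_mul, one_smul, one_smul, map_add]
    module
  · rw [neg_one_mul, map_add, map_smul]
    module

theorem continuous_waveGroup (W : H1 × L2) : Continuous fun t => waveGroup t W :=
  (continuousOn_univ.1 (isWaveSolution_waveGroup W).continuousOn_u).prodMk
    (continuousOn_univ.1 (isWaveSolution_waveGroup W).continuousOn_v)

theorem disp_waveGroup_add (t : ℝ) (V W : H1 × L2) :
    disp (waveGroup t (V + W)) = disp (waveGroup t V) + disp (waveGroup t W) := by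
  simp only [disp_waveGroup, Prod.snd_add, map_add]
  rw [intervalIntegral.integral_add ((continuous_translate _).intervalIntegrable _ _)
    ((continuous_translate _).intervalIntegrable _ _)]
  module

theorem disp_waveGroup_sub (t : ℝ) (V W : H1 × L2) :
    disp (waveGroup t (V - W)) = disp (waveGroup t V) - disp (waveGroup t W) := by
  rw [eq_sub_iff_add_eq, ← disp_waveGroup_add, sub_add_cancel]

theorem norm_integral_translate_le (a b : ℝ) (f : L2) :
    ‖∫ s in a..b, translate s f‖ ≤ ‖f‖ * |b - a| :=
  intervalIntegral.norm_integral_le_of_norm_le_const fun s _ => (norm_translate s f).le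

theorem norm_translate_sub_le {f f' : L2} (h : IsWeakDeriv f f') (t : ℝ) :
    ‖translate t f - f‖ ≤ ‖f'‖ * |t| := by
  have := norm_integral_translate_le 0 t f'
  rwa [← translate_sub_translate h, translate_zero, sub_zero] at this

theorem norm_half_integral_le (t : ℝ) (f : L2) :
    ‖(1 / 2 : ℝ) • ∫ s in (-t)..t, translate s f‖ ≤ |t| * ‖f‖ := by
  have h := norm_integral_translate_le (-t) t f
  have e : |t - -t| = 2 * |t| := by rw [sub_neg_eq_add, ← two_mul, abs_mul, abs_two]
  rw [e] at h
  rw [norm_smul, Real.norm_of_nonneg (by norm_num)]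
  linarith

theorem norm_disp_waveGroup_le (t : ℝ) (W : H1 × L2) :
    ‖disp (waveGroup t W)‖ ≤ ‖disp W‖ + |t| * ‖W.2‖ := by
  rw [disp_waveGroup, smul_add]
  refine (norm_add_le _ _).trans (add_le_add ?_ (norm_half_integral_le t W.2))
  rw [norm_smul, Real.norm_of_nonneg (by norm_num)]
  have := norm_add_le (translate t (disp W)) (translate (-t) (disp W))
  rw [norm_translate, norm_translate] at this
  linarith

theorem norm_disp_waveGroup_sub_le (t : ℝ) (W : H1 × L2) :
    ‖disp (waveGroup t W) - disp W‖ ≤ |t| * (‖W.1‖ + ‖W.2‖) := by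
  have e : disp (waveGroup t W) - disp W = (1 / 2 : ℝ) • (translate t (disp W) - disp W)
      + (1 / 2 : ℝ) • (translate (-t) (disp W) - disp W)
      + (1 / 2 : ℝ) • ∫ s in (-t)..t, translate s W.2 := by
    rw [disp_waveGroup]
    module
  have h : IsWeakDeriv (disp W) (H1.deriv W.1) := W.1.2
  have h1 := norm_translate_sub_le h t
  have h2 := norm_translate_sub_le h (-t)
  rw [abs_neg] at h2
  have h3 := mul_le_mul_of_nonneg_right (H1.norm_deriv_le W.1) (abs_nonneg t)
  rw [e]
  refine (norm_add₃_le).trans ?_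
  have h4 := norm_half_integral_le t W.2
  rw [norm_smul, norm_smul, Real.norm_of_nonneg (by norm_num)]
  nlinarith

end Group

section WeightedIntegral

variable {E : Type*} [NormedAddCommGroup E] [NormedSpace ℝ E]

theorem norm_weighted_integral_le {τ B : ℝ} (hτ : 0 ≤ τ) {k : ℝ → E}
    (hk : ∀ s ∈ Icc 0 τ, ‖k s‖ ≤ B) : ‖∫ s in (0 : ℝ)..τ, (τ - s) • k s‖ ≤ τ ^ 2 * B := by
  have h : ‖∫ s in (0 : ℝ)..τ, (τ - s) • k s‖ ≤ τ * B * |τ - 0| := by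
    refine intervalIntegral.norm_integral_le_of_norm_le_const fun s hs => ?_
    rw [uIoc_of_le hτ] at hs
    rw [norm_smul, Real.norm_of_nonneg (by linarith [hs.2])]
    exact mul_le_mul (by linarith [hs.1]) (hk s ⟨hs.1.le, hs.2⟩) (norm_nonneg _) hτ
  rw [sub_zero, abs_of_nonneg hτ] at h
  linarith

theorem integral_weight (τ : ℝ) : ∫ s in (0 : ℝ)..τ, (τ - s) = τ ^ 2 / 2 := by
  rw [intervalIntegral.integral_sub (by simp) (by simp), integral_id]
  simp
  ring

variable [CompleteSpace E]

theorem weighted_integral_eq_integral_integral {k : ℝ → E} (hk : Continuous k) (τ : ℝ) :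
    ∫ s in (0 : ℝ)..τ, (τ - s) • k s = ∫ s in (0 : ℝ)..τ, ∫ r in (0 : ℝ)..s, k r := by
  have hK : ∀ s, HasDerivAt (fun s => ∫ r in (0 : ℝ)..s, k r) (k s) s := fun s =>
    intervalIntegral.integral_hasDerivAt_right (hk.intervalIntegrable _ _)
      (hk.stronglyMeasurableAtFilter _ _) hk.continuousAt
  have hKc : Continuous fun s => ∫ r in (0 : ℝ)..s, k r :=
    continuous_iff_continuousAt.2 fun s => (hK s).continuousAt
  have h := intervalIntegral.integral_eq_sub_of_hasDerivAt (a := 0) (b := τ)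
    (f := fun s => (τ - s) • ∫ r in (0 : ℝ)..s, k r)
    (fun s _ => ((hasDerivAt_id s).const_sub τ).smul (hK s))
    (Continuous.intervalIntegrable (by fun_prop) _ _)
  rw [intervalIntegral.integral_add (Continuous.intervalIntegrable (by fun_prop) _ _)
    (Continuous.intervalIntegrable (by fun_prop) _ _)] at h
  simp only [sub_self, zero_smul, intervalIntegral.integral_same, smul_zero, id, neg_smul,
    one_smul, intervalIntegral.integral_neg] at h
  exact eq_of_sub_eq_zero (by rw [sub_eq_add_neg]; exact h)

end WeightedIntegral

section Step

variable {g : ℝ → ℝ}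

/-- The data `(-g(u), g'(u) v)` to which the filter `φ₂(-2τA)` of the corrected Lie splitting is
applied. -/
def correction (g : ℝ → ℝ) (U : H1 × L2) : H1 × L2 := (-nonlinH1 g U.1, nonlinDeriv g U.1 U.2)

/-- The increment of the corrected Lie splitting before the free flow, `τ (0, g(u)) + τ² φ₂(-2τA)
(-g(u), g'(u) v)`. -/
def increment (g : ℝ → ℝ) (τ : ℝ) (U : H1 × L2) : H1 × L2 :=
  τ • ((0 : H1), nonlin g U.1) + τ ^ 2 • phi2 τ (correction g U)

theorem correctedLieStep_eq (g : ℝ → ℝ) (τ : ℝ) (U : H1 × L2) :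
    correctedLieStep g τ U = waveGroup τ (U + increment g τ U) := by
  rw [increment, ← add_assoc]
  rfl

theorem map_phi2 (Λ : H1 × L2 →L[ℝ] L2) {τ : ℝ} (hτ : 0 < τ) (W : H1 × L2) :
    Λ (τ ^ 2 • phi2 τ W) = ∫ s in (0 : ℝ)..τ, (τ - s) • Λ (waveGroup (-2 * s) W) := by
  rw [phi2, smul_smul, mul_one_div_cancel (by positivity), one_smul,
    ← Λ.intervalIntegral_comp_comm]
  · simp only [map_smul]
  · have := continuous_waveGroup W
    exact Continuous.intervalIntegrable (by fun_prop) _ _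

theorem disp_correction (hg : ContDiff ℝ 2 g) (U : H1 × L2) :
    disp (correction g U) = -nonlin g U.1 := by
  rw [disp_apply, correction, map_neg, toL2_nonlinH1 hg]

/-- The correction exchanges the two characteristic variables. -/
theorem char_correction (hg : ContDiff ℝ 2 g) (ε : ℝ) (U : H1 × L2) :
    char ε (correction g U) = nonlinDeriv g U.1 (char (-ε) U) := by
  rw [char_apply, char_apply, correction, map_neg, deriv_nonlinH1 hg, nonlinDeriv_add hg,
    nonlinDeriv_smul hg]
  module

theorem char_increment (hg : ContDiff ℝ 2 g) {ε : ℝ} (hε : ε = 1 ∨ ε = -1) {τ : ℝ} (hτ : 0 < τ)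
    (U : H1 × L2) : char ε (increment g τ U) = τ • nonlin g U.1
      + ∫ s in (0 : ℝ)..τ,
          (τ - s) • translate (ε * (-2 * s)) (nonlinDeriv g U.1 (char (-ε) U)) := by
  rw [increment, map_add, map_phi2 _ hτ, map_smul, char_apply, map_zero, smul_zero, add_zero]
  simp only [char_waveGroup hε, char_correction hg]

theorem disp_increment {τ : ℝ} (hτ : 0 < τ) (U : H1 × L2) :
    disp (increment g τ U)
      = ∫ s in (0 : ℝ)..τ, (τ - s) • disp (waveGroup (-2 * s) (correction g U)) := by
  rw [increment, map_add, map_phi2 _ hτ, map_smul, disp_apply, map_zero, smul_zero, zero_add]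

variable {R L : ℝ}

theorem norm_char_correction_sub_le (hg : ContDiff ℝ 2 g) (hB : C2Bound g (4 * R) L) {ε : ℝ}
    (hε : ε = 1 ∨ ε = -1) {U V : H1 × L2} (hU : ‖U.1‖ ≤ R) (hV : ‖V.1‖ ≤ R) (hV' : ‖V.2‖ ≤ R) :
    ‖char ε (correction g U - correction g V)‖ ≤ (L + 8 * L * R) * charNorm (U - V) := by
  have hε' : -ε = 1 ∨ -ε = -1 := by rcases hε with rfl | rfl <;> simp
  rw [map_sub, char_correction hg, char_correction hg]
  have e : nonlinDeriv g U.1 (char (-ε) U) - nonlinDeriv g V.1 (char (-ε) V)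
      = nonlinDeriv g U.1 (char (-ε) (U - V))
        + (nonlinDeriv g U.1 (char (-ε) V) - nonlinDeriv g V.1 (char (-ε) V)) := by
    rw [map_sub, nonlinDeriv_sub hg]
    abel
  rw [e]
  have h1 := norm_nonlinDeriv_le hg hB hU (char (-ε) (U - V))
  have h2 := norm_nonlinDeriv_sub_le hg hB hU hV (char (-ε) V)
  have h3 : ‖U.1 - V.1‖ ≤ charNorm (U - V) := norm_fst_le_charNorm (U - V)
  have h4 := norm_char_le_charNorm hε' (U - V)
  have h5 : ‖char (-ε) V‖ ≤ 2 * R := (norm_char_le hε' V).trans (by linarith)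
  have hL := hB.nonneg
  have h6 := mul_le_mul_of_nonneg_left h4 hL
  have h7 : L * (4 * ‖U.1 - V.1‖) * ‖char (-ε) V‖ ≤ L * (4 * charNorm (U - V)) * (2 * R) :=
    mul_le_mul (by gcongr) h5 (norm_nonneg _) (by have := charNorm_nonneg (U - V); positivity)
  refine (norm_add_le _ _).trans ?_
  linarith

/-- Local Lipschitz continuity of one step, with constant `1 + O(τ)`. -/
theorem charNorm_correctedLieStep_sub_le (hg : ContDiff ℝ 2 g) (hB : C2Bound g (4 * R) L)
    {τ : ℝ} (hτ : 0 < τ) (hτ1 : τ ≤ 1) {U V : H1 × L2}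
    (hU : ‖U.1‖ ≤ R) (hV : ‖V.1‖ ≤ R) (hV' : ‖V.2‖ ≤ R) :
    charNorm (correctedLieStep g τ U - correctedLieStep g τ V)
      ≤ (1 + τ * (1 + 4 * L + 5 * (L + 8 * L * R))) * charNorm (U - V) := by
  set e := charNorm (U - V) with he
  set D := L + 8 * L * R with hD
  have hL := hB.nonneg
  have hR : 0 ≤ R := (norm_nonneg _).trans hU
  have he0 : 0 ≤ e := charNorm_nonneg _
  have hD0 : 0 ≤ D := by positivity
  have hLD : τ ^ 2 * D * e ≤ τ * D * e := by
    have : τ ^ 2 ≤ τ := by nlinarith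
    gcongr
  have hn : ‖nonlin g U.1 - nonlin g V.1‖ ≤ L * e := by
    refine (norm_nonlin_sub_le hg hB hU hV).trans (mul_le_mul_of_nonneg_left ?_ hL)
    rw [← map_sub]
    exact (H1.norm_toL2_le _).trans (norm_fst_le_charNorm (U - V))
  have hc : ∀ ε : ℝ, (ε = 1 ∨ ε = -1) → ∀ t : ℝ,
      ‖translate t (nonlinDeriv g U.1 (char (-ε) U) - nonlinDeriv g V.1 (char (-ε) V))‖ ≤ D * e := by
    intro ε hε t
    rw [norm_translate, ← char_correction hg, ← char_correction hg, ← map_sub]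
    exact norm_char_correction_sub_le hg hB hε hU hV hV'
  -- the characteristic variables before the free flow
  have hX : ∀ ε : ℝ, (ε = 1 ∨ ε = -1) →
      ‖char ε (U + increment g τ U - (V + increment g τ V))‖
        ≤ ‖char ε (U - V)‖ + τ * (L + D) * e := by
    intro ε hε
    have e1 : char ε (U + increment g τ U - (V + increment g τ V)) = char ε (U - V)
        + (τ • (nonlin g U.1 - nonlin g V.1) + ∫ s in (0 : ℝ)..τ, (τ - s) • translate
          (ε * (-2 * s)) (nonlinDeriv g U.1 (char (-ε) U) - nonlinDeriv g V.1 (char (-ε) V))) := by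
      have hi : ∀ f : L2, IntervalIntegrable (fun s => (τ - s) • translate (ε * (-2 * s)) f)
          volume 0 τ := fun f => by
        have := (continuous_translate f).comp
          ((continuous_const_mul ε).comp (continuous_const_mul (-2 : ℝ)))
        exact ((continuous_const.sub continuous_id).smul this).intervalIntegrable _ _
      simp only [map_sub, map_add, char_increment hg hε hτ, smul_sub]
      rw [intervalIntegral.integral_sub (hi _) (hi _)]
      abel
    rw [e1]
    refine (norm_add_le _ _).trans (add_le_add_right ((norm_add_le _ _).trans ?_) _)
    rw [norm_smul, Real.norm_of_nonneg hτ.le]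
    have h2 := norm_weighted_integral_le hτ.le (fun s _ => hc ε hε (ε * (-2 * s)))
    nlinarith
  have hX1 := hX 1 (Or.inl rfl)
  have hX2 := hX (-1) (Or.inr rfl)
  -- the displacement before the free flow
  have hXd : ‖disp (U + increment g τ U - (V + increment g τ V))‖
      ≤ ‖disp (U - V)‖ + τ * (L + 2 * D) * e := by
    have e1 : disp (U + increment g τ U - (V + increment g τ V)) = disp (U - V)
        + ∫ s in (0 : ℝ)..τ, (τ - s) •
          disp (waveGroup (-2 * s) (correction g U - correction g V)) := by
      have hi : ∀ W : H1 × L2, IntervalIntegrable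
          (fun s => (τ - s) • disp (waveGroup (-2 * s) W)) volume 0 τ := fun W => by
        have := continuous_waveGroup W
        exact Continuous.intervalIntegrable (by fun_prop) _ _
      simp only [map_sub, map_add, disp_increment hτ, disp_waveGroup_sub, smul_sub]
      rw [intervalIntegral.integral_sub (hi _) (hi _)]
      abel
    rw [e1]
    refine (norm_add_le _ _).trans (add_le_add_right ?_ _)
    have h2 : ∀ s ∈ Icc 0 τ, ‖disp (waveGroup (-2 * s) (correction g U - correction g V))‖
        ≤ L * e + 2 * (D * e) := by
      intro s hs
      refine (norm_disp_waveGroup_le _ _).trans (add_le_add ?_ ?_)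
      · rw [map_sub, disp_correction hg, disp_correction hg, neg_sub_neg, norm_sub_rev]
        exact hn
      · have h3 := norm_snd_le_char (correction g U - correction g V)
        have h4 := norm_char_correction_sub_le hg hB (Or.inl rfl : (1 : ℝ) = 1 ∨ (1 : ℝ) = -1)
          hU hV hV'
        have h5 := norm_char_correction_sub_le hg hB (Or.inr rfl : (-1 : ℝ) = 1 ∨ (-1 : ℝ) = -1)
          hU hV hV'
        refine mul_le_mul ?_ (by linarith) (norm_nonneg _) (by norm_num)
        rw [abs_mul, abs_of_nonneg hs.1]
        norm_num
        linarith [hs.2]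
    refine (norm_weighted_integral_le hτ.le h2).trans ?_
    have : τ ^ 2 ≤ τ := by nlinarith
    have h6 : τ ^ 2 * (L * e + 2 * (D * e)) ≤ τ * (L * e + 2 * (D * e)) := by gcongr
    linarith
  have hfin : ‖disp (correctedLieStep g τ U - correctedLieStep g τ V)‖
      ≤ ‖disp (U - V)‖ + τ * (L + 2 * D) * e + τ * (e + (L + D) * e) := by
    rw [map_sub, correctedLieStep_eq, correctedLieStep_eq, ← disp_waveGroup_sub]
    refine (norm_disp_waveGroup_le _ _).trans (add_le_add hXd ?_)
    rw [abs_of_pos hτ]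
    refine mul_le_mul_of_nonneg_left ?_ hτ.le
    refine (norm_snd_le_char _).trans ?_
    have h1 := norm_char_le_charNorm (Or.inl rfl : (1 : ℝ) = 1 ∨ (1 : ℝ) = -1) (U - V)
    have h2 := norm_char_le_charNorm (Or.inr rfl : (-1 : ℝ) = 1 ∨ (-1 : ℝ) = -1) (U - V)
    have h3 : τ * (L + D) * e ≤ 1 * (L + D) * e := by gcongr
    linarith
  have hcf : ∀ ε : ℝ, (ε = 1 ∨ ε = -1) →
      ‖char ε (correctedLieStep g τ U - correctedLieStep g τ V)‖
        ≤ ‖char ε (U - V)‖ + τ * (L + D) * e := by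
    intro ε hε
    rw [map_sub, correctedLieStep_eq, correctedLieStep_eq, char_waveGroup hε, char_waveGroup hε,
      ← map_sub, ← map_sub, norm_translate]
    exact hX ε hε
  have h1 := hcf 1 (Or.inl rfl)
  have h2 := hcf (-1) (Or.inr rfl)
  have h3 : e = ‖disp (U - V)‖ + ‖char 1 (U - V)‖ + ‖char (-1) (U - V)‖ := rfl
  rw [charNorm]
  linarith

end Step

/-! ### Duhamel's formula along the characteristics -/

/-- Product rule for `⟪c, y⟫` when `c` is continuous in norm but differentiable only weakly. -/
theorem hasDerivWithinAt_inner_of_weak {c y : ℝ → L2} {S : Set ℝ} {s a : ℝ} {y' : L2}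
    (hc : ContinuousWithinAt c S s) (hca : HasDerivWithinAt (fun r => ⟪c r, y s⟫) a S s)
    (hy : HasDerivWithinAt y y' S s) :
    HasDerivWithinAt (fun r => ⟪c r, y r⟫) (a + ⟪c s, y'⟫) S s := by
  have h1 : HasDerivWithinAt (fun r => ⟪c s, y r⟫) ⟪c s, y'⟫ S s :=
    (innerSL ℝ (c s)).hasFDerivAt.comp_hasDerivWithinAt s hy
  have h2 : HasDerivWithinAt (fun r => ⟪c r - c s, y r - y s⟫) 0 S s := by
    rw [hasDerivWithinAt_iff_isLittleO]
    have hO : (fun r => y r - y s) =O[𝓝[S] s] fun r => r - s := hy.hasFDerivWithinAt.isBigO_sub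
    have ho : (fun r => c r - c s) =o[𝓝[S] s] fun _ => (1 : ℝ) := by
      rw [Asymptotics.isLittleO_one_iff]
      simpa using hc.sub_const (c s)
    have h3 : (fun r => ‖c r - c s‖ * ‖y r - y s‖) =o[𝓝[S] s] fun r => r - s := by
      simpa using ho.norm_left.mul_isBigO hO.norm_left
    refine (Asymptotics.IsBigO.of_bound 1 (Eventually.of_forall fun r => ?_)).trans_isLittleO h3
    simp only [sub_self, inner_zero_right, sub_zero, smul_zero, one_mul]
    exact (norm_inner_le_norm _ _).trans (le_abs_self _)
  have h4 := (hca.add h1).add h2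
  rw [add_zero] at h4
  refine (h4.add_const (-⟪c s, y s⟫)).congr (fun r _ => ?_) ?_
  · simp only [Pi.add_apply, inner_sub_left, inner_sub_right]
    ring
  · simp only [Pi.add_apply, inner_sub_left, inner_sub_right]
    ring

/-- `H¹(𝕋)` is dense in `L²(𝕋)`: the means `∫₀ʰ T_s F ds` lie in `H¹(𝕋)`, and `h⁻¹` times them
tend to `F` as `h → 0`. -/
theorem eq_zero_of_forall_inner_H1 {F : L2} (h : ∀ w : H1, ⟪F, H1.toL2 w⟫ = 0) : F = 0 := by
  have h1 : HasDerivAt (fun b => ∫ s in (0 : ℝ)..b, translate s F) F 0 := by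
    have := intervalIntegral.integral_hasDerivAt_right
      ((continuous_translate F).intervalIntegrable 0 0)
      ((continuous_translate F).stronglyMeasurableAtFilter _ _)
      (continuous_translate F).continuousAt
    rwa [translate_zero] at this
  have h2 : HasDerivAt (fun b => ⟪F, ∫ s in (0 : ℝ)..b, translate s F⟫) ⟪F, F⟫ 0 :=
    (innerSL ℝ F).hasFDerivAt.comp_hasDerivAt 0 h1
  have h3 : (fun b => ⟪F, ∫ s in (0 : ℝ)..b, translate s F⟫) = fun _ => 0 := by
    funext b
    exact h ⟨WithLp.toLp 2 (_, _), isWeakDeriv_integral_translate F 0 b⟩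
  rw [h3] at h2
  exact inner_self_eq_zero.1 (h2.unique (hasDerivAt_const 0 _))

theorem inner_translate_left (t : ℝ) (f h : L2) :
    ⟪translate (-t) f, h⟫ = ⟪f, translate t h⟫ := by
  rw [← (translate t).inner_map_map (translate (-t) f) h, translate_translate, add_neg_cancel,
    translate_zero]

section Solution

variable {g : ℝ → ℝ} {T : ℝ} {u : ℝ → H1} {v : ℝ → L2}

theorem continuousOn_char (hs : IsSemilinearWaveSolution g T u v) (ε : ℝ) :
    ContinuousOn (fun t => char ε (u t, v t)) (Icc 0 T) :=
  (char ε).continuous.comp_continuousOn (hs.continuousOn_u.prodMk hs.continuousOn_v)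

/-- The transport equation `∂ₜ c = ε ∂ₓ c + g(u)` for the characteristic variable `c`, tested along
the characteristics. -/
theorem hasDerivWithinAt_inner_char (hs : IsSemilinearWaveSolution g T u v) {ε : ℝ}
    (hε : ε = 1 ∨ ε = -1) (w : H1) {t : ℝ} (ht : t ∈ Icc 0 T) :
    HasDerivWithinAt (fun s => ⟪char ε (u s, v s), translate (ε * s) (H1.toL2 w)⟫)
      ⟪nonlin g (u t), translate (ε * t) (H1.toL2 w)⟫ (Icc 0 T) t := by
  have hw : IsWeakDeriv (H1.toL2 w) (H1.deriv w) := w.2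
  set w₀ : H1 := translateH1 (ε * t) w
  have hv : HasDerivWithinAt (fun s => ⟪v s, H1.toL2 w₀⟫)
      (-⟪H1.deriv (u t), H1.deriv w₀⟫ + ⟪nonlin g (u t), H1.toL2 w₀⟫) (Icc 0 T) t :=
    ((ContinuousLinearMap.apply ℝ ℝ w₀).comp
      Hneg1.ofDual.symm.toContinuousLinearEquiv.toContinuousLinearMap).hasFDerivAt
      |>.comp_hasDerivWithinAt t (hs.hasDerivWithinAt_v t ht)
  have hu : HasDerivWithinAt (fun s => ⟪H1.deriv (u s), H1.toL2 w₀⟫)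
      (-⟪H1.deriv w₀, v t⟫) (Icc 0 T) t := by
    have h1 : HasDerivWithinAt (fun s => ⟪H1.deriv w₀, H1.toL2 (u s)⟫) ⟪H1.deriv w₀, v t⟫
        (Icc 0 T) t :=
      (innerSL ℝ (H1.deriv w₀)).hasFDerivAt.comp_hasDerivWithinAt t (hs.hasDerivWithinAt_u t ht)
    have e : (fun s => ⟪H1.deriv (u s), H1.toL2 w₀⟫)
        = fun s => -⟪H1.deriv w₀, H1.toL2 (u s)⟫ := by
      funext s
      have hus : IsWeakDeriv (H1.toL2 (u s)) (H1.deriv (u s)) := (u s).2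
      have hw₀ : IsWeakDeriv (H1.toL2 w₀) (H1.deriv w₀) := w₀.2
      have := hus.inner_add_inner hw₀
      rw [real_inner_comm] at this
      linarith
    rw [e]
    exact h1.fun_neg
  have hc : HasDerivWithinAt (fun s => ⟪char ε (u s, v s), translate (ε * t) (H1.toL2 w)⟫)
      (-⟪H1.deriv (u t), H1.deriv w₀⟫ + ⟪nonlin g (u t), H1.toL2 w₀⟫
        + ε * -⟪H1.deriv w₀, v t⟫) (Icc 0 T) t := by
    refine (hv.add (hu.const_mul ε)).congr (fun s _ => ?_) ?_
    · rw [char_apply, inner_add_left, real_inner_smul_left]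
      rfl
    · rw [char_apply, inner_add_left, real_inner_smul_left]
      rfl
  have hy : HasDerivWithinAt (fun s => translate (ε * s) (H1.toL2 w))
      (ε • translate (ε * t) (H1.deriv w)) (Icc 0 T) t :=
    ((hasDerivAt_translate hw (ε * t)).scomp t
      (by simpa using (hasDerivAt_id t).const_mul ε)).hasDerivWithinAt
  refine (hasDerivWithinAt_inner_of_weak (continuousOn_char hs ε t ht) hc hy).congr_deriv ?_
  have e : translate (ε * t) (H1.deriv w) = H1.deriv w₀ := rfl
  rw [e, char_apply, inner_add_left, real_inner_smul_right, real_inner_smul_left,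
    real_inner_smul_right, real_inner_comm (v t) (H1.deriv w₀)]
  have hε2 : ε * ε = 1 := by rcases hε with rfl | rfl <;> norm_num
  change _ = ⟪nonlin g (u t), H1.toL2 w₀⟫
  linear_combination ⟪H1.deriv (u t), H1.deriv w₀⟫ * hε2

theorem integral_eq_sub_of_hasDerivWithinAt {E : Type*} [NormedAddCommGroup E] [NormedSpace ℝ E]
    [CompleteSpace E] {f f' : ℝ → E} {a b : ℝ} (hab : a ≤ b)
    (hd : ∀ s ∈ Icc a b, HasDerivWithinAt f (f' s) (Icc a b) s) (hf' : ContinuousOn f' (Icc a b)) :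
    ∫ s in a..b, f' s = f b - f a := by
  refine intervalIntegral.integral_eq_sub_of_hasDerivAt_of_le hab
    (fun s hs => (hd s hs).continuousWithinAt)
    (fun s hs => (hd s (Ioo_subset_Icc_self hs)).hasDerivAt (Icc_mem_nhds hs.1 hs.2)) ?_
  exact ContinuousOn.intervalIntegrable (by rwa [uIcc_of_le hab])

/-- Duhamel's formula along the characteristics. -/
theorem char_duhamel (hg : ContDiff ℝ 2 g) (hs : IsSemilinearWaveSolution g T u v) {ε : ℝ}
    (hε : ε = 1 ∨ ε = -1) {a b : ℝ} (ha : 0 ≤ a) (hab : a ≤ b) (hb : b ≤ T) :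
    char ε (u b, v b) = translate (ε * (b - a)) (char ε (u a, v a))
      + ∫ s in a..b, translate (ε * (b - s)) (nonlin g (u s)) := by
  have hsub : Icc a b ⊆ Icc 0 T := Icc_subset_Icc ha hb
  have hn : ContinuousOn (fun s => nonlin g (u s)) (Icc a b) :=
    (continuous_nonlin hg).comp_continuousOn (hs.continuousOn_u.mono hsub)
  have hni : ContinuousOn (fun s => translate (-(ε * s)) (nonlin g (u s))) (Icc a b) :=
    continuousOn_translate (by fun_prop) hn
  have hint : IntervalIntegrable (fun s => translate (-(ε * s)) (nonlin g (u s))) volume a b :=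
    ContinuousOn.intervalIntegrable (by rwa [uIcc_of_le hab])
  have key : translate (-(ε * b)) (char ε (u b, v b)) - translate (-(ε * a)) (char ε (u a, v a))
      - ∫ s in a..b, translate (-(ε * s)) (nonlin g (u s)) = 0 := by
    refine eq_zero_of_forall_inner_H1 fun w => ?_
    have h1 := integral_eq_sub_of_hasDerivWithinAt hab
      (fun s h => (hasDerivWithinAt_inner_char hs hε w (hsub h)).mono hsub)
      (hn.inner (𝕜 := ℝ) ((continuous_translate (H1.toL2 w)).comp_continuousOn
        (continuous_const_mul ε).continuousOn))
    have h2 : ⟪∫ s in a..b, translate (-(ε * s)) (nonlin g (u s)), H1.toL2 w⟫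
        = ∫ s in a..b, ⟪nonlin g (u s), translate (ε * s) (H1.toL2 w)⟫ := by
      rw [real_inner_comm]
      refine ((innerSL ℝ (H1.toL2 w)).intervalIntegral_comp_comm hint).symm.trans ?_
      refine intervalIntegral.integral_congr fun s _ => ?_
      change ⟪H1.toL2 w, translate (-(ε * s)) (nonlin g (u s))⟫ = _
      rw [real_inner_comm, inner_translate_left]
    rw [inner_sub_left, inner_sub_left, inner_translate_left, inner_translate_left, h2, h1,
      sub_self]
  have h3 := congrArg (translate (ε * b)) key
  rw [map_sub, map_sub, map_zero, translate_translate, translate_translate, add_neg_cancel,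
    translate_zero] at h3
  have h4 : translate (ε * b) (∫ s in a..b, translate (-(ε * s)) (nonlin g (u s)))
      = ∫ s in a..b, translate (ε * (b - s)) (nonlin g (u s)) := by
    refine ((translate (ε * b)).toContinuousLinearMap.intervalIntegral_comp_comm hint).symm.trans ?_
    refine intervalIntegral.integral_congr fun s _ => ?_
    change translate (ε * b) (translate (-(ε * s)) (nonlin g (u s))) = _
    rw [translate_translate]
    congr 2
    ring
  have e : ε * b + -(ε * a) = ε * (b - a) := by ring
  rw [h4, e] at h3
  rw [sub_sub, sub_eq_zero] at h3
  exact h3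

variable {R L : ℝ}

theorem norm_char_sub_translate_le (hg : ContDiff ℝ 2 g) (hB : C2Bound g (4 * R) L)
    (hs : IsSemilinearWaveSolution g T u v) (hu : ∀ t ∈ Icc 0 T, ‖u t‖ ≤ R) {ε : ℝ}
    (hε : ε = 1 ∨ ε = -1) {a b : ℝ} (ha : 0 ≤ a) (hab : a ≤ b) (hb : b ≤ T) :
    ‖char ε (u b, v b) - translate (ε * (b - a)) (char ε (u a, v a))‖ ≤ 3 * L * (b - a) := by
  rw [char_duhamel hg hs hε ha hab hb, add_sub_cancel_left]
  have h : ‖∫ s in a..b, translate (ε * (b - s)) (nonlin g (u s))‖ ≤ 3 * L * |b - a| := by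
    refine intervalIntegral.norm_integral_le_of_norm_le_const fun s h => ?_
    rw [uIoc_of_le hab] at h
    rw [norm_translate]
    exact norm_nonlin_le hg hB (hu s ⟨ha.trans h.1.le, h.2.trans hb⟩)
  rwa [abs_of_nonneg (sub_nonneg.2 hab)] at h

/-- Up to the bounded contribution of the nonlinearity, the characteristic variables are dominated
by their transported initial values. -/
theorem enorm_char_le (hg : ContDiff ℝ 2 g) (hB : C2Bound g (4 * R) L)
    (hs : IsSemilinearWaveSolution g T u v) (hu : ∀ t ∈ Icc 0 T, ‖u t‖ ≤ R) {ε : ℝ}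
    (hε : ε = 1 ∨ ε = -1) {t : ℝ} (ht : t ∈ Icc 0 T) :
    ∀ᵐ x : Torus, ‖char ε (u t, v t) x‖ₑ
      ≤ ‖char ε (u 0, v 0) (x + ((ε * t : ℝ) : Torus))‖ₑ + ENNReal.ofReal (L * T) := by
  have hsub : Icc 0 t ⊆ Icc 0 T := Icc_subset_Icc_right ht.2
  have hn : ContinuousOn (fun s => nonlin g (u s)) (Icc 0 t) :=
    (continuous_nonlin hg).comp_continuousOn (hs.continuousOn_u.mono hsub)
  have hni : ContinuousOn (fun s => translate (ε * (t - s)) (nonlin g (u s))) (Icc 0 t) :=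
    continuousOn_translate (by fun_prop) hn
  have h1 := enorm_intervalIntegral_le (F := fun s => translate (ε * (t - s)) (nonlin g (u s))) ht.1
    (ContinuousOn.intervalIntegrable (by rwa [uIcc_of_le ht.1]))
    (Φ := fun _ _ => ENNReal.ofReal L) measurable_const
    (fun s h => by
      filter_upwards [coeFn_translate (ε * (t - s)) (nonlin g (u s)),
        ae_shift (abs_nonlin_le hg hB (hu s (hsub h))) ((ε * (t - s) : ℝ) : Torus)] with x h1 h2
      rw [h1, ← ofReal_norm]
      exact ENNReal.ofReal_le_ofReal h2)
  have e := char_duhamel hg hs hε le_rfl ht.1 ht.2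
  rw [sub_zero] at e
  filter_upwards [h1, coeFn_translate (ε * t) (char ε (u 0, v 0)), Lp.coeFn_add
    (translate (ε * t) (char ε (u 0, v 0)))
    (∫ s in (0 : ℝ)..t, translate (ε * (t - s)) (nonlin g (u s)))] with x h1 h2 h3
  rw [e, h3, Pi.add_apply, h2]
  refine (enorm_add_le _ _).trans (add_le_add_right (h1.trans ?_) _)
  rw [setLIntegral_const, Real.volume_Ioc, sub_zero, ← ENNReal.ofReal_mul hB.nonneg]
  exact ENNReal.ofReal_le_ofReal (mul_le_mul_of_nonneg_left ht.2 hB.nonneg)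

theorem norm_toL2_sub_le (hs : IsSemilinearWaveSolution g T u v)
    (hv : ∀ t ∈ Icc 0 T, ‖v t‖ ≤ R) {a b : ℝ} (ha : 0 ≤ a) (hab : a ≤ b) (hb : b ≤ T) :
    ‖H1.toL2 (u b) - H1.toL2 (u a)‖ ≤ R * (b - a) := by
  have hsub : Icc a b ⊆ Icc 0 T := Icc_subset_Icc ha hb
  exact norm_image_sub_le_of_norm_deriv_le_segment' (f := fun s => H1.toL2 (u s))
    (fun s h => (hs.hasDerivWithinAt_u s (hsub h)).mono hsub)
    (fun s h => hv s (hsub (Ico_subset_Icc_self h))) b (right_mem_Icc.2 hab)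

/-- Second-order accuracy of the frozen nonlinearity in Duhamel's formula. -/
theorem norm_char_sub_translate_sub_le (hg : ContDiff ℝ 2 g) (hB : C2Bound g (4 * R) L)
    (hs : IsSemilinearWaveSolution g T u v) (hu : ∀ t ∈ Icc 0 T, ‖u t‖ ≤ R)
    (hv : ∀ t ∈ Icc 0 T, ‖v t‖ ≤ R) {ε : ℝ}
    (hε : ε = 1 ∨ ε = -1) {a b : ℝ} (ha : 0 ≤ a) (hab : a ≤ b) (hb : b ≤ T) :
    ‖char ε (u b, v b) - translate (ε * (b - a)) (char ε (u a, v a))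
      - (b - a) • nonlin g (u a)‖ ≤ 2 * L * R * (b - a) ^ 2 := by
  have hsub : Icc a b ⊆ Icc 0 T := Icc_subset_Icc ha hb
  have hn : ContinuousOn (fun s => nonlin g (u s)) (Icc a b) :=
    (continuous_nonlin hg).comp_continuousOn (hs.continuousOn_u.mono hsub)
  have hni : ContinuousOn (fun s => translate (ε * (b - s)) (nonlin g (u s))) (Icc a b) :=
    continuousOn_translate (by fun_prop) hn
  rw [char_duhamel hg hs hε ha hab hb, add_sub_cancel_left,
    ← intervalIntegral.integral_const, ← intervalIntegral.integral_sub
      (ContinuousOn.intervalIntegrable (by rwa [uIcc_of_le hab])) intervalIntegrable_const]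
  have h : ‖∫ s in a..b, (translate (ε * (b - s)) (nonlin g (u s)) - nonlin g (u a))‖
      ≤ 2 * L * R * (b - a) * |b - a| := by
    refine intervalIntegral.norm_integral_le_of_norm_le_const fun s h => ?_
    rw [uIoc_of_le hab] at h
    have hsT : s ∈ Icc 0 T := hsub (Ioc_subset_Icc_self h)
    have haT : a ∈ Icc 0 T := hsub (left_mem_Icc.2 hab)
    have h1 := norm_translate_sub_le (isWeakDeriv_nonlin hg (u s)) (ε * (b - s))
    have h2 := norm_nonlin_sub_le hg hB (hu s hsT) (hu a haT)
    have h3 := norm_toL2_sub_le hs hv ha h.1.le hsT.2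
    have h4 := norm_nonlinDeriv_le hg hB (hu s hsT) (H1.deriv (u s))
    have h5 : |ε * (b - s)| = b - s := by
      have hε1 : |ε| = 1 := by rcases hε with rfl | rfl <;> simp
      rw [abs_mul, hε1, one_mul, abs_of_nonneg (by linarith [h.2])]
    have hL := hB.nonneg
    have h6 : ‖H1.deriv (u s)‖ ≤ R := (H1.norm_deriv_le _).trans (hu s hsT)
    have hR : 0 ≤ R := (norm_nonneg _).trans h6
    rw [h5] at h1
    have h7 : ‖nonlinDeriv g (u s) (H1.deriv (u s))‖ * (b - s) ≤ L * R * (b - a) :=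
      mul_le_mul (h4.trans (mul_le_mul_of_nonneg_left h6 hL)) (by linarith [h.1])
        (by linarith [h.2]) (by positivity)
    have h8 : L * ‖H1.toL2 (u s) - H1.toL2 (u a)‖ ≤ L * (R * (b - a)) :=
      mul_le_mul_of_nonneg_left (h3.trans (mul_le_mul_of_nonneg_left (by linarith [h.2]) hR)) hL
    calc ‖translate (ε * (b - s)) (nonlin g (u s)) - nonlin g (u a)‖
        ≤ ‖translate (ε * (b - s)) (nonlin g (u s)) - nonlin g (u s)‖
          + ‖nonlin g (u s) - nonlin g (u a)‖ := norm_sub_le_norm_sub_add_norm_sub _ _ _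
      _ ≤ 2 * L * R * (b - a) := by linarith
  rw [abs_of_nonneg (sub_nonneg.2 hab)] at h
  refine h.trans (le_of_eq (by ring))

end Solution

/-! ### Transversality of the two families of characteristics -/

/-- The space-time integral `∫ₐᵇ ∫ P(x + 2 ε r)² Q(x)² dx dr` that measures how two profiles, moving
in opposite directions, overlap in the time interval `[a, b]`. -/
def overlap (ε : ℝ) (P Q : Torus → ℝ≥0∞) (a b : ℝ) : ℝ≥0∞ :=
  ∫⁻ r in Ioc a b, ∫⁻ x : Torus, P (x + ((ε * (2 * r) : ℝ) : Torus)) ^ 2 * Q x ^ 2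

theorem measurable_coe_torus : Measurable (fun t : ℝ => (t : Torus)) := AddCircle.measurable_mk'

theorem lintegral_Ioc_periods (F : Torus → ℝ≥0∞) (a : ℝ) (m : ℕ) :
    ∫⁻ r in Ioc a (a + m * (2 * Real.pi)), F (r : Torus) = m * ∫⁻ y, F y := by
  induction m with
  | zero => simp
  | succ m ih =>
    have h1 : a ≤ a + m * (2 * Real.pi) := by
      have := Real.two_pi_pos
      have : 0 ≤ m * (2 * Real.pi) := by positivity
      linarith
    have e : a + (m + 1 : ℕ) * (2 * Real.pi) = a + m * (2 * Real.pi) + 2 * Real.pi := by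
      push_cast
      ring
    rw [e, ← Ioc_union_Ioc_eq_Ioc h1 (le_add_of_nonneg_right Real.two_pi_pos.le),
      lintegral_union measurableSet_Ioc (Ioc_disjoint_Ioc_of_le le_rfl), ih,
      AddCircle.lintegral_preimage, Nat.cast_succ, add_mul, one_mul]

theorem exists_lintegral_shift_le (T : ℝ) : ∃ N : ℕ, ∀ ε : ℝ, ε = 1 ∨ ε = -1 →
    ∀ F : Torus → ℝ≥0∞, Measurable F → ∀ x : Torus,
      ∫⁻ r in Ioc 0 T, F (x + ((ε * (2 * r) : ℝ) : Torus)) ≤ N * ∫⁻ y, F y := by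
  obtain ⟨m, hm⟩ := exists_nat_gt (2 * T / (2 * Real.pi))
  rw [div_lt_iff₀ Real.two_pi_pos] at hm
  refine ⟨2 * m, fun ε hε F hF x => ?_⟩
  set I : Set ℝ := Ioc (-(m * (2 * Real.pi))) (-(m * (2 * Real.pi)) + (2 * m : ℕ) * (2 * Real.pi))
  set G : ℝ → ℝ≥0∞ := I.indicator fun y => F (x + (y : Torus)) with hG
  have hGm : Measurable G :=
    (measurable_comp_shift hF measurable_const measurable_coe_torus).indicator measurableSet_Ioc
  have hc : (2 * ε) ≠ 0 := by rcases hε with rfl | rfl <;> norm_num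
  calc ∫⁻ r in Ioc 0 T, F (x + ((ε * (2 * r) : ℝ) : Torus))
      ≤ ∫⁻ r in Ioc 0 T, G (2 * ε * r) := by
        refine setLIntegral_mono' measurableSet_Ioc fun r hr => ?_
        have hI : 2 * ε * r ∈ I := by
          simp only [I, mem_Ioc]
          push_cast
          rcases hε with rfl | rfl <;> constructor <;> nlinarith [hr.1, hr.2]
        rw [hG, indicator_of_mem hI]
        refine le_of_eq ?_
        congr 3
        ring
    _ ≤ ∫⁻ r, G (2 * ε * r) := setLIntegral_le_lintegral _ _
    _ = ∫⁻ y, G y ∂(Measure.map (2 * ε * ·) volume) :=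
        (lintegral_map hGm (measurable_const_mul _)).symm
    _ ≤ ∫⁻ y, G y := by
        rw [Real.map_volume_mul_left hc, lintegral_smul_measure]
        refine mul_le_of_le_one_left zero_le ?_
        rw [ENNReal.ofReal_le_one]
        rcases hε with rfl | rfl <;> norm_num [abs_of_pos]
    _ = ∫⁻ y in I, F (x + (y : Torus)) := lintegral_indicator measurableSet_Ioc _
    _ = (2 * m : ℕ) * ∫⁻ y, F (x + y) :=
        lintegral_Ioc_periods (fun y => F (x + y)) _ _
    _ = (2 * m : ℕ) * ∫⁻ y, F y := by rw [lintegral_add_left_eq_self F x]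

/-- Transversality: two profiles moving in opposite directions meet each other point of the circle
a bounded number of times in bounded time, so the product of their squares is integrable in
space-time although it need not be integrable at a fixed time. -/
theorem exists_overlap_le (T : ℝ) : ∃ N : ℕ, ∀ ε : ℝ, ε = 1 ∨ ε = -1 →
    ∀ P Q : Torus → ℝ≥0∞, Measurable P → Measurable Q →
      overlap ε P Q 0 T ≤ N * (∫⁻ x, P x ^ 2) * ∫⁻ x, Q x ^ 2 := by
  obtain ⟨N, hN⟩ := exists_lintegral_shift_le T
  refine ⟨N, fun ε hε P Q hP hQ => ?_⟩
  have hm : Measurable (Function.uncurry fun (r : ℝ) (x : Torus) =>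
      P (x + ((ε * (2 * r) : ℝ) : Torus)) ^ 2 * Q x ^ 2) :=
    ((measurable_comp_shift hP measurable_snd (measurable_coe_torus.comp
      (measurable_const.mul (measurable_const.mul measurable_fst)))).pow_const 2).mul
      ((hQ.comp measurable_snd).pow_const 2)
  rw [overlap, lintegral_lintegral_swap hm.aemeasurable, ← lintegral_const_mul _ (hQ.pow_const 2)]
  refine lintegral_mono fun x => ?_
  have hPx : Measurable fun r : ℝ => P (x + ((ε * (2 * r) : ℝ) : Torus)) ^ 2 :=
    (measurable_comp_shift hP measurable_const (measurable_coe_torus.comp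
      (measurable_const.mul (measurable_const.mul measurable_id)))).pow_const 2
  rw [lintegral_mul_const _ hPx]
  exact mul_le_mul_left (hN ε hε (fun y => P y ^ 2) (hP.pow_const 2) x) _

theorem sum_overlap (ε : ℝ) (P Q : Torus → ℝ≥0∞) {τ : ℝ} (hτ : 0 ≤ τ) (N : ℕ) :
    ∑ n ∈ Finset.range N, overlap ε P Q (n * τ) (n * τ + τ) = overlap ε P Q 0 (N * τ) := by
  induction N with
  | zero => simp [overlap]
  | succ N ih =>
    have e : ((N + 1 : ℕ) : ℝ) * τ = N * τ + τ := by push_cast; ring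
    rw [Finset.sum_range_succ, ih, e, overlap, overlap, overlap,
      ← Ioc_union_Ioc_eq_Ioc (by positivity : (0 : ℝ) ≤ N * τ) (le_add_of_nonneg_right hτ),
      lintegral_union measurableSet_Ioc (Ioc_disjoint_Ioc_of_le le_rfl)]

theorem overlap_mono (ε : ℝ) (P Q : Torus → ℝ≥0∞) {a b b' : ℝ} (h : b ≤ b') :
    overlap ε P Q a b ≤ overlap ε P Q a b' := lintegral_mono_set (Ioc_subset_Ioc_right h)

/-- The overlap over a time step `[t, t + s]` when the second profile is held at its position at
time `t`: shifting `x` and `r` restores the definition. -/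
theorem lintegral_eq_overlap (ε : ℝ) (P Q : Torus → ℝ≥0∞) (t s : ℝ) :
    ∫⁻ r in Ioc 0 s, ∫⁻ x : Torus, P (x + ((ε * (t + 2 * r) : ℝ) : Torus)) ^ 2
      * Q (x + ((-ε * t : ℝ) : Torus)) ^ 2 = overlap ε P Q t (t + s) := by
  set H : ℝ → ℝ≥0∞ := fun r => ∫⁻ x : Torus,
    P (x + ((ε * (2 * r) : ℝ) : Torus)) ^ 2 * Q x ^ 2 with hH
  have e1 : ∀ r : ℝ, (∫⁻ x : Torus, P (x + ((ε * (t + 2 * r) : ℝ) : Torus)) ^ 2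
      * Q (x + ((-ε * t : ℝ) : Torus)) ^ 2) = H (r + t) := by
    intro r
    simp only [hH]
    rw [← lintegral_add_right_eq_self (μ := (volume : Measure Torus))
      (fun x : Torus => P (x + ((ε * (2 * (r + t)) : ℝ) : Torus)) ^ 2 * Q x ^ 2)
      ((-ε * t : ℝ) : Torus)]
    refine lintegral_congr fun x => ?_
    have e2 : x + ((-ε * t : ℝ) : Torus) + ((ε * (2 * (r + t)) : ℝ) : Torus)
        = x + ((ε * (t + 2 * r) : ℝ) : Torus) := by
      rw [add_assoc, ← AddCircle.coe_add]
      congr 2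
      ring
    rw [e2]
  simp only [e1]
  have h5 := (measurePreserving_add_right (volume : Measure ℝ) t).setLIntegral_comp_preimage_emb
    (measurableEmbedding_addRight t) H (Ioc t (t + s))
  rw [preimage_add_const_Ioc, sub_self, add_sub_cancel_left] at h5
  exact h5

theorem enorm_sq_eq_lintegral (f : L2) : ‖f‖ₑ ^ 2 = ∫⁻ x, ‖f x‖ₑ ^ 2 := by
  have h := eLpNorm_nnreal_pow_eq_lintegral (f := f) (μ := (volume : Measure Torus)) (p := 2)
    (by norm_num)
  rw [Lp.enorm_def]
  simpa using h

theorem lintegral_Ioc_sq_le {f : ℝ → ℝ≥0∞} (hf : Measurable f) (s : ℝ) :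
    (∫⁻ r in Ioc 0 s, f r) ^ 2 ≤ ENNReal.ofReal s * ∫⁻ r in Ioc 0 s, f r ^ 2 := by
  have h := ENNReal.lintegral_mul_le_Lp_mul_Lq (volume.restrict (Ioc 0 s))
    Real.HolderConjugate.two_two (f := fun _ => 1) (g := f) measurable_const.aemeasurable
    hf.aemeasurable
  simp only [Pi.mul_apply, one_mul, lintegral_const, Measure.restrict_apply_univ,
    Real.volume_Ioc, sub_zero, ENNReal.rpow_two, one_pow] at h
  refine (pow_le_pow_left₀ zero_le h 2).trans (le_of_eq ?_)
  have key : ∀ a : ℝ≥0∞, (a ^ (1 / 2 : ℝ)) ^ 2 = a := fun a => by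
    rw [← ENNReal.rpow_natCast, ← ENNReal.rpow_mul]
    norm_num
  rw [mul_pow, key, key]

section Solution

variable {g : ℝ → ℝ} {T : ℝ} {u : ℝ → H1} {v : ℝ → L2}

/-- Measured along a characteristic, the displacement changes only by the integral of the
characteristic variable. -/
theorem translate_toL2_sub (hs : IsSemilinearWaveSolution g T u v) (ε : ℝ) {t s : ℝ} (ht : 0 ≤ t)
    (hs0 : 0 ≤ s) (hts : t + s ≤ T) :
    translate (ε * s) (H1.toL2 (u (t + s))) - H1.toL2 (u t)
      = ∫ r in (0 : ℝ)..s, translate (ε * r) (char ε (u (t + r), v (t + r))) := by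
  have hmaps : MapsTo (fun r => t + r) (Icc 0 s) (Icc 0 T) := fun r hr =>
    ⟨by linarith [hr.1], by linarith [hr.2]⟩
  have hd : ∀ r ∈ Icc 0 s, HasDerivWithinAt (fun r => translate (ε * r) (H1.toL2 (u (t + r))))
      (translate (ε * r) (char ε (u (t + r), v (t + r)))) (Icc 0 s) r := by
    intro r hr
    have h1 : HasDerivWithinAt (fun r => H1.toL2 (u (t + r))) (v (t + r)) (Icc 0 s) r := by
      have := (hs.hasDerivWithinAt_u (t + r) (hmaps hr)).scomp r
        ((hasDerivAt_id r).const_add t).hasDerivWithinAt hmaps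
      rwa [one_smul] at this
    exact hasDerivWithinAt_translate_curve ε h1 (u (t + r)).2
  have hc : ContinuousOn (fun r => translate (ε * r) (char ε (u (t + r), v (t + r)))) (Icc 0 s) :=
    continuousOn_translate (by fun_prop)
      ((continuousOn_char hs ε).comp (by fun_prop : ContinuousOn (fun r => t + r) (Icc 0 s)) hmaps)
  have h := integral_eq_sub_of_hasDerivWithinAt hs0 hd hc
  rw [h, mul_zero, translate_zero, add_zero]

variable {R L : ℝ}

/-- The profile, translated with speed one, that dominates the characteristic variable of a
solution with initial state `U`; the constant `c` bounds the contribution of the nonlinearity. -/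
def profile (ε c : ℝ) (U : H1 × L2) (x : Torus) : ℝ≥0∞ := ‖char ε U x‖ₑ + ENNReal.ofReal c

theorem measurable_profile (ε c : ℝ) (U : H1 × L2) : Measurable (profile ε c U) :=
  (Lp.stronglyMeasurable _).measurable.enorm.add_const _

theorem lintegral_profile_sq_le (ε : ℝ) {c : ℝ} (hc : 0 ≤ c) (U : H1 × L2) :
    ∫⁻ x, profile ε c U x ^ 2 ≤ ENNReal.ofReal (2 * ‖char ε U‖ ^ 2 + 14 * c ^ 2) := by
  have hm : Measurable fun x => ‖char ε U x‖ₑ := (Lp.stronglyMeasurable _).measurable.enorm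
  have h1 : ∀ x, profile ε c U x ^ 2
      ≤ ENNReal.ofReal 2 * ‖char ε U x‖ₑ ^ 2 + ENNReal.ofReal (2 * c ^ 2) := by
    intro x
    rw [profile, ← ofReal_norm, ← ENNReal.ofReal_add (norm_nonneg _) hc,
      ← ENNReal.ofReal_pow (by positivity), ← ENNReal.ofReal_pow (by positivity),
      ← ENNReal.ofReal_mul (by norm_num), ← ENNReal.ofReal_add (by positivity) (by positivity)]
    exact ENNReal.ofReal_le_ofReal (by nlinarith [sq_nonneg (‖char ε U x‖ - c)])
  refine (lintegral_mono h1).trans ?_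
  rw [lintegral_add_right _ measurable_const, lintegral_const_mul _ (hm.pow_const 2),
    ← enorm_sq_eq_lintegral, lintegral_const, AddCircle.measure_univ, ← ofReal_norm,
    ← ENNReal.ofReal_pow (by positivity), ← ENNReal.ofReal_mul (by norm_num),
    ← ENNReal.ofReal_mul (by positivity), ← ENNReal.ofReal_add (by positivity)
      (by have := Real.pi_pos; positivity)]
  refine ENNReal.ofReal_le_ofReal ?_
  nlinarith [Real.pi_lt_d2, sq_nonneg c]

theorem enorm_char_le_profile (hg : ContDiff ℝ 2 g) (hB : C2Bound g (4 * R) L)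
    (hs : IsSemilinearWaveSolution g T u v) (hu : ∀ t ∈ Icc 0 T, ‖u t‖ ≤ R) {ε : ℝ}
    (hε : ε = 1 ∨ ε = -1) {t : ℝ} (ht : t ∈ Icc 0 T) :
    ∀ᵐ x : Torus, ‖char ε (u t, v t) x‖ₑ
      ≤ profile ε (L * T) (u 0, v 0) (x + ((ε * t : ℝ) : Torus)) :=
  enorm_char_le hg hB hs hu hε ht

/-- The error of freezing `g'(u)` along one characteristic and multiplying with the other
characteristic variable is controlled by the overlap of the two profiles. -/
theorem enorm_nonlinDeriv_sub_sq_le (hg : ContDiff ℝ 2 g) (hB : C2Bound g (4 * R) L)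
    (hs : IsSemilinearWaveSolution g T u v) (hu : ∀ t ∈ Icc 0 T, ‖u t‖ ≤ R) {ε : ℝ}
    (hε : ε = 1 ∨ ε = -1) {t s : ℝ} (ht : 0 ≤ t) (hs0 : 0 ≤ s) (hts : t + s ≤ T) :
    ‖nonlinDeriv g (translateH1 (ε * s) (u (t + s))) (char (-ε) (u t, v t))
        - nonlinDeriv g (u t) (char (-ε) (u t, v t))‖ₑ ^ 2
      ≤ ENNReal.ofReal L ^ 2 * (ENNReal.ofReal s
          * overlap ε (profile ε (L * T) (u 0, v 0)) (profile (-ε) (L * T) (u 0, v 0))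
            t (t + s)) := by
  set P := profile ε (L * T) (u 0, v 0)
  set Q := profile (-ε) (L * T) (u 0, v 0)
  set w := char (-ε) (u t, v t)
  have hε' : -ε = 1 ∨ -ε = -1 := by rcases hε with rfl | rfl <;> simp
  have hPm : Measurable P := measurable_profile _ _ _
  have hQm : Measurable Q := measurable_profile _ _ _
  have htT : t ∈ Icc 0 T := ⟨ht, by linarith⟩
  have htsT : t + s ∈ Icc 0 T := ⟨by linarith, hts⟩
  have hmaps : MapsTo (fun r => t + r) (Icc 0 s) (Icc 0 T) := fun r hr =>
    ⟨by linarith [hr.1], by linarith [hr.2]⟩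
  have hshift : Measurable (Function.uncurry fun (r : ℝ) (x : Torus) =>
      P (x + ((ε * (t + 2 * r) : ℝ) : Torus))) :=
    measurable_comp_shift hPm measurable_snd (measurable_coe_torus.comp
      (measurable_const.mul (measurable_const.add (measurable_const.mul measurable_fst))))
  -- pointwise bound of the change of the displacement along the characteristic
  have hint : IntervalIntegrable (fun r => translate (ε * r) (char ε (u (t + r), v (t + r))))
      volume 0 s := by
    refine ContinuousOn.intervalIntegrable ?_
    rw [uIcc_of_le hs0]
    exact continuousOn_translate (by fun_prop) ((continuousOn_char hs ε).comp
      (by fun_prop : ContinuousOn (fun r => t + r) (Icc 0 s)) hmaps)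
  have hD := enorm_intervalIntegral_le hs0 hint hshift (fun r hr => by
    filter_upwards [coeFn_translate (ε * r) (char ε (u (t + r), v (t + r))),
      ae_shift (enorm_char_le_profile hg hB hs hu hε (hmaps hr)) ((ε * r : ℝ) : Torus)] with x h1 h2
    rw [h1]
    refine h2.trans (le_of_eq ?_)
    rw [add_assoc, ← AddCircle.coe_add]
    congr 3
    ring)
  rw [← translate_toL2_sub hs ε ht hs0 hts] at hD
  have hw : ∀ᵐ x : Torus, ‖w x‖ₑ ≤ Q (x + ((-ε * t : ℝ) : Torus)) :=
    enorm_char_le_profile hg hB hs hu hε' htT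
  have hf := abs_nonlinDeriv_sub_le hg hB (u := translateH1 (ε * s) (u (t + s))) (w := u t)
    (by rw [norm_translateH1]; exact hu _ htsT) (hu t htT) w
  rw [enorm_sq_eq_lintegral]
  have hP2 : ∀ x : Torus, Measurable fun r : ℝ => P (x + ((ε * (t + 2 * r) : ℝ) : Torus)) := fun x =>
    measurable_comp_shift hPm measurable_const (measurable_coe_torus.comp
      (measurable_const.mul (measurable_const.add (measurable_const.mul measurable_id))))
  have hprod : Measurable (Function.uncurry fun (x : Torus) (r : ℝ) =>
      P (x + ((ε * (t + 2 * r) : ℝ) : Torus)) ^ 2 * Q (x + ((-ε * t : ℝ) : Torus)) ^ 2) :=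
    ((measurable_comp_shift hPm measurable_fst (measurable_coe_torus.comp (measurable_const.mul
      (measurable_const.add (measurable_const.mul measurable_snd))))).pow_const 2).mul
      ((measurable_comp_shift hQm measurable_fst measurable_const).pow_const 2)
  calc ∫⁻ x, ‖(nonlinDeriv g (translateH1 (ε * s) (u (t + s))) w - nonlinDeriv g (u t) w : L2) x‖ₑ ^ 2
      ≤ ∫⁻ x, ENNReal.ofReal L ^ 2 * (ENNReal.ofReal s * ∫⁻ r in Ioc 0 s,
          P (x + ((ε * (t + 2 * r) : ℝ) : Torus)) ^ 2 * Q (x + ((-ε * t : ℝ) : Torus)) ^ 2) := by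
        refine lintegral_mono_ae ?_
        filter_upwards [hD, hw, hf] with x h1 h2 h3
        have h4 : ‖(nonlinDeriv g (translateH1 (ε * s) (u (t + s))) w
            - nonlinDeriv g (u t) w : L2) x‖ₑ ≤ ENNReal.ofReal L
            * (∫⁻ r in Ioc 0 s, P (x + ((ε * (t + 2 * r) : ℝ) : Torus)))
            * Q (x + ((-ε * t : ℝ) : Torus)) := by
          rw [← ofReal_norm]
          refine (ENNReal.ofReal_le_ofReal h3).trans ?_
          rw [ENNReal.ofReal_mul (mul_nonneg hB.nonneg (abs_nonneg _)),
            ENNReal.ofReal_mul hB.nonneg, ← Real.norm_eq_abs, ← Real.norm_eq_abs, ofReal_norm,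
            ofReal_norm]
          gcongr
          exact h1
        refine (pow_le_pow_left₀ zero_le h4 2).trans ?_
        rw [mul_pow, mul_pow, lintegral_mul_const _ ((hP2 x).pow_const 2), mul_assoc,
          ← mul_assoc (ENNReal.ofReal s)]
        gcongr
        exact lintegral_Ioc_sq_le (hP2 x) s
    _ = ENNReal.ofReal L ^ 2 * (ENNReal.ofReal s * ∫⁻ r in Ioc 0 s, ∫⁻ x : Torus,
          P (x + ((ε * (t + 2 * r) : ℝ) : Torus)) ^ 2 * Q (x + ((-ε * t : ℝ) : Torus)) ^ 2) := by
        rw [lintegral_const_mul' _ _ (by simp), lintegral_const_mul' _ _ (by simp),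
          lintegral_lintegral_swap hprod.aemeasurable]
    _ = ENNReal.ofReal L ^ 2 * (ENNReal.ofReal s * overlap ε P Q t (t + s)) := by
        rw [lintegral_eq_overlap]

end Solution

/-! ### The local error -/

section LocalError

variable {g : ℝ → ℝ} {T : ℝ} {u : ℝ → H1} {v : ℝ → L2} {R L : ℝ}

theorem hasDerivWithinAt_shift {E : Type*} [NormedAddCommGroup E] [NormedSpace ℝ E] {f : ℝ → E}
    {f' : E} {t s τ : ℝ} (ht : 0 ≤ t) (hτ : t + τ ≤ T)
    (h : HasDerivWithinAt f f' (Icc 0 T) (t + s)) :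
    HasDerivWithinAt (fun r => f (t + r)) f' (Icc 0 τ) s := by
  have hmaps : MapsTo (fun r => t + r) (Icc 0 τ) (Icc 0 T) := fun r hr =>
    ⟨by linarith [hr.1], by linarith [hr.2]⟩
  have := h.scomp s ((hasDerivAt_id s).const_add t).hasDerivWithinAt hmaps
  rwa [one_smul] at this

/-- Along the characteristics of one family, the nonlinearity is differentiated into the product of
`g'(u)` with the characteristic variable of the other family. -/
theorem hasDerivWithinAt_translate_nonlin (hg : ContDiff ℝ 2 g)
    (hs : IsSemilinearWaveSolution g T u v) (ε : ℝ) {t s τ : ℝ} (ht : 0 ≤ t) (hτ : t + τ ≤ T)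
    (hsτ : s ∈ Icc 0 τ) :
    HasDerivWithinAt (fun r => translate (-ε * r) (nonlin g (u (t + r))))
      (translate (-ε * s) (nonlinDeriv g (u (t + s)) (char (-ε) (u (t + s), v (t + s)))))
      (Icc 0 τ) s := by
  have htT : t + s ∈ Icc 0 T := ⟨by linarith [hsτ.1], by linarith [hsτ.2]⟩
  have hmaps : MapsTo (fun r => t + r) (Icc 0 τ) (Icc 0 T) := fun r hr =>
    ⟨by linarith [hr.1], by linarith [hr.2]⟩
  have hc : ContinuousOn (fun r => u (t + r)) (Icc 0 τ) :=
    hs.continuousOn_u.comp (by fun_prop : ContinuousOn (fun r => t + r) (Icc 0 τ)) hmaps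
  have h1 := hasDerivWithinAt_nonlin hg (hc s hsτ)
    (hasDerivWithinAt_shift ht hτ (hs.hasDerivWithinAt_u (t + s) htT))
  refine (hasDerivWithinAt_translate_curve (-ε) h1
    (isWeakDeriv_nonlin hg (u (t + s)))).congr_deriv ?_
  rw [char_apply, nonlinDeriv_add hg, nonlinDeriv_smul hg]

theorem norm_nonlinDeriv_translate_sub_le (hg : ContDiff ℝ 2 g) (hB : C2Bound g (4 * R) L)
    (hs : IsSemilinearWaveSolution g T u v) (hu : ∀ t ∈ Icc 0 T, ‖u t‖ ≤ R) {ε : ℝ}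
    (hε : ε = 1 ∨ ε = -1) {t s τ : ℝ} (ht : 0 ≤ t) (hsτ : s ∈ Icc 0 τ) (hτ : t + τ ≤ T)
    (hfin : overlap ε (profile ε (L * T) (u 0, v 0)) (profile (-ε) (L * T) (u 0, v 0))
      t (t + τ) ≠ ⊤) :
    ‖nonlinDeriv g (translateH1 (ε * s) (u (t + s))) (char (-ε) (u t, v t))
        - nonlinDeriv g (u t) (char (-ε) (u t, v t))‖
      ≤ L * ((τ + (overlap ε (profile ε (L * T) (u 0, v 0)) (profile (-ε) (L * T) (u 0, v 0))
          t (t + τ)).toReal) / 2) := by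
  have h := enorm_nonlinDeriv_sub_sq_le hg hB hs hu hε ht hsτ.1 (by linarith [hsτ.2])
  set P := profile ε (L * T) (u 0, v 0)
  set Q := profile (-ε) (L * T) (u 0, v 0)
  set X := nonlinDeriv g (translateH1 (ε * s) (u (t + s))) (char (-ε) (u t, v t))
        - nonlinDeriv g (u t) (char (-ε) (u t, v t))
  set a := (overlap ε P Q t (t + τ)).toReal with ha
  have ha0 : 0 ≤ a := ENNReal.toReal_nonneg
  have hτ0 : 0 ≤ τ := hsτ.1.trans hsτ.2
  have hL := hB.nonneg
  have h1 : ‖X‖ₑ ^ 2 ≤ ENNReal.ofReal (L ^ 2 * (τ * a)) := by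
    refine h.trans ?_
    rw [ENNReal.ofReal_mul (by positivity), ENNReal.ofReal_mul hτ0, ENNReal.ofReal_pow hL, ha,
      ENNReal.ofReal_toReal hfin]
    gcongr
    · exact hsτ.2
    · exact overlap_mono ε P Q (by linarith [hsτ.2])
  rw [← ofReal_norm, ← ENNReal.ofReal_pow (norm_nonneg _),
    ENNReal.ofReal_le_ofReal_iff (by positivity)] at h1
  refine (sq_le_sq₀ (norm_nonneg _) (by positivity)).1 (h1.trans ?_)
  rw [mul_pow]
  refine mul_le_mul_of_nonneg_left ?_ (by positivity)
  nlinarith [sq_nonneg (τ - a)]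

/-- Local error of one step in the characteristic variables. -/
theorem norm_char_local_error_le (hg : ContDiff ℝ 2 g) (hB : C2Bound g (4 * R) L)
    (hs : IsSemilinearWaveSolution g T u v) (hu : ∀ t ∈ Icc 0 T, ‖u t‖ ≤ R) {ε : ℝ}
    (hε : ε = 1 ∨ ε = -1) {t τ : ℝ} (ht : 0 ≤ t) (hτ0 : 0 < τ) (hτ : t + τ ≤ T)
    (hfin : overlap ε (profile ε (L * T) (u 0, v 0)) (profile (-ε) (L * T) (u 0, v 0))
      t (t + τ) ≠ ⊤) :
    ‖char ε ((u (t + τ), v (t + τ)) - correctedLieStep g τ (u t, v t))‖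
      ≤ τ ^ 2 * (3 * L ^ 2 * τ + L * ((τ + (overlap ε (profile ε (L * T) (u 0, v 0))
          (profile (-ε) (L * T) (u 0, v 0)) t (t + τ)).toReal) / 2)) := by
  have hbd := fun s hsτ => norm_nonlinDeriv_translate_sub_le hg hB hs hu hε (s := s) ht hsτ hτ hfin
  set a := (overlap ε (profile ε (L * T) (u 0, v 0)) (profile (-ε) (L * T) (u 0, v 0))
      t (t + τ)).toReal
  have hε' : -ε = 1 ∨ -ε = -1 := by rcases hε with rfl | rfl <;> simp
  have hL := hB.nonneg
  set B := 3 * L ^ 2 * τ + L * ((τ + a) / 2)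
  set w := char (-ε) (u t, v t)
  set Z := nonlinDeriv g (u t) w
  have hmaps : MapsTo (fun r => t + r) (Icc 0 τ) (Icc 0 T) := fun r hr =>
    ⟨by linarith [hr.1], by linarith [hr.2]⟩
  set f : ℝ → L2 := fun s => translate (-ε * s) (nonlin g (u (t + s))) with hf
  set k : ℝ → L2 := fun s => translate (ε * (-2 * s)) Z with hk
  have hkc : Continuous k := (continuous_translate Z).comp (by fun_prop)
  have hfd := fun s hsτ => hasDerivWithinAt_translate_nonlin hg hs ε (s := s) ht hτ hsτ
  have hfc : ContinuousOn f (Icc 0 τ) := fun s hsτ => (hfd s hsτ).continuousWithinAt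
  have hKd : ∀ s, HasDerivAt (fun s => ∫ r in (0 : ℝ)..s, k r) (k s) s := fun s =>
    intervalIntegral.integral_hasDerivAt_right (hkc.intervalIntegrable _ _)
      (hkc.stronglyMeasurableAtFilter _ _) hkc.continuousAt
  -- the derivative of `f` differs from the filtered correction by at most `B`
  have hder : ∀ s ∈ Icc 0 τ, ‖translate (-ε * s) (nonlinDeriv g (u (t + s))
      (char (-ε) (u (t + s), v (t + s)))) - k s‖ ≤ B := by
    intro s hsτ
    have e1 : translate (-ε * s) (nonlinDeriv g (u (t + s)) (char (-ε) (u (t + s), v (t + s))))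
        = translate (ε * (-2 * s)) (nonlinDeriv g (translateH1 (ε * s) (u (t + s)))
          (translate (ε * s) (char (-ε) (u (t + s), v (t + s))))) := by
      rw [← translate_nonlinDeriv hg, translate_translate]
      congr 2
      ring
    have e2 : nonlinDeriv g (translateH1 (ε * s) (u (t + s)))
          (translate (ε * s) (char (-ε) (u (t + s), v (t + s)))) - Z
        = nonlinDeriv g (translateH1 (ε * s) (u (t + s)))
            (translate (ε * s) (char (-ε) (u (t + s), v (t + s))) - w)
          + (nonlinDeriv g (translateH1 (ε * s) (u (t + s))) w - Z) := by
      rw [nonlinDeriv_sub hg]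
      abel
    have h1 := norm_nonlinDeriv_le hg hB (u := translateH1 (ε * s) (u (t + s)))
      (by rw [norm_translateH1]; exact hu _ (hmaps hsτ))
      (translate (ε * s) (char (-ε) (u (t + s), v (t + s))) - w)
    have h2 : ‖translate (ε * s) (char (-ε) (u (t + s), v (t + s))) - w‖ ≤ 3 * L * s := by
      have h3 := norm_char_sub_translate_le hg hB hs hu hε' ht
        (le_add_of_nonneg_right hsτ.1) (hmaps hsτ).2
      rw [add_sub_cancel_left, ← norm_translate (ε * s), map_sub, translate_translate] at h3
      have e3 : ε * s + -ε * s = 0 := by ring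
      rwa [e3, translate_zero] at h3
    rw [e1, hk, ← map_sub, norm_translate, e2]
    refine (norm_add_le _ _).trans (add_le_add (h1.trans ?_) (hbd s hsτ))
    calc L * ‖translate (ε * s) (char (-ε) (u (t + s), v (t + s))) - w‖
        ≤ L * (3 * L * τ) := mul_le_mul_of_nonneg_left
          (h2.trans (mul_le_mul_of_nonneg_left hsτ.2 (by positivity))) hL
      _ = 3 * L ^ 2 * τ := by ring
  have hmv : ∀ s ∈ Icc 0 τ, ‖f s - f 0 - ∫ r in (0 : ℝ)..s, k r‖ ≤ B * τ := by
    intro s hsτ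
    have h := norm_image_sub_le_of_norm_deriv_le_segment'
      (f := fun s => f s - ∫ r in (0 : ℝ)..s, k r)
      (fun s hsτ => (hfd s hsτ).fun_sub (hKd s).hasDerivWithinAt)
      (fun s hsτ => hder s (Ico_subset_Icc_self hsτ)) s hsτ
    simp only [intervalIntegral.integral_same, sub_zero] at h
    rw [sub_right_comm] at h
    have hB0 : 0 ≤ B := (norm_nonneg _).trans (hder s hsτ)
    exact h.trans (mul_le_mul_of_nonneg_left hsτ.2 hB0)
  -- the local error in terms of `f` and the correction
  have hfi : IntervalIntegrable f volume 0 τ :=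
    ContinuousOn.intervalIntegrable (by rwa [uIcc_of_le hτ0.le])
  have hKc : Continuous fun s => ∫ r in (0 : ℝ)..s, k r :=
    continuous_iff_continuousAt.2 fun s => (hKd s).continuousAt
  have hexact : char ε (u (t + τ), v (t + τ))
      = translate (ε * τ) (char ε (u t, v t) + ∫ s in (0 : ℝ)..τ, f s) := by
    rw [char_duhamel hg hs hε ht (le_add_of_nonneg_right hτ0.le) hτ, add_sub_cancel_left, map_add]
    congr 1
    have h1 := intervalIntegral.integral_comp_add_left (a := 0) (b := τ)
      (fun s => translate (ε * (t + τ - s)) (nonlin g (u s))) t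
    rw [add_zero] at h1
    rw [← h1]
    refine Eq.trans ?_ ((translate (ε * τ)).toContinuousLinearMap.intervalIntegral_comp_comm hfi)
    refine intervalIntegral.integral_congr fun s _ => ?_
    change _ = translate (ε * τ) (translate (-ε * s) (nonlin g (u (t + s))))
    rw [translate_translate]
    congr 2
    ring
  have hf0 : f 0 = nonlin g (u t) := by
    simp only [hf, mul_zero, translate_zero, add_zero]
  have herr : char ε ((u (t + τ), v (t + τ)) - correctedLieStep g τ (u t, v t))
      = translate (ε * τ) (∫ s in (0 : ℝ)..τ, (f s - f 0 - ∫ r in (0 : ℝ)..s, k r)) := by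
    rw [intervalIntegral.integral_sub (hfi.sub intervalIntegrable_const)
      (hKc.intervalIntegrable _ _), intervalIntegral.integral_sub hfi intervalIntegrable_const,
      intervalIntegral.integral_const, ← weighted_integral_eq_integral_integral hkc, map_sub,
      hexact, correctedLieStep_eq, char_waveGroup hε, ← map_sub, map_add, char_increment hg hε hτ0,
      hf0, sub_zero]
    congr 1
    abel
  rw [herr, norm_translate]
  have h : ‖∫ s in (0 : ℝ)..τ, (f s - f 0 - ∫ r in (0 : ℝ)..s, k r)‖ ≤ B * τ * |τ - 0| := by
    refine intervalIntegral.norm_integral_le_of_norm_le_const fun s h => ?_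
    rw [uIoc_of_le hτ0.le] at h
    exact hmv s (Ioc_subset_Icc_self h)
  rw [sub_zero, abs_of_pos hτ0] at h
  refine h.trans (le_of_eq (by ring))

theorem norm_half_integral_translate_sub_le {f f' : L2} (h : IsWeakDeriv f f') {τ : ℝ}
    (hτ : 0 ≤ τ) : ‖(1 / 2 : ℝ) • (∫ r in (-τ)..τ, translate r f) - τ • f‖ ≤ τ ^ 2 * ‖f'‖ := by
  have e : (1 / 2 : ℝ) • (∫ r in (-τ)..τ, translate r f) - τ • f
      = (1 / 2 : ℝ) • ∫ r in (-τ)..τ, (translate r f - f) := by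
    rw [intervalIntegral.integral_sub ((continuous_translate f).intervalIntegrable _ _)
      intervalIntegrable_const, intervalIntegral.integral_const]
    module
  have h1 : ‖∫ r in (-τ)..τ, (translate r f - f)‖ ≤ ‖f'‖ * τ * |τ - -τ| := by
    refine intervalIntegral.norm_integral_le_of_norm_le_const fun r hr => ?_
    rw [uIoc_of_le (by linarith)] at hr
    exact (norm_translate_sub_le h r).trans
      (mul_le_mul_of_nonneg_left (abs_le.2 ⟨hr.1.le, hr.2⟩) (norm_nonneg _))
  rw [e, norm_smul, Real.norm_of_nonneg (by norm_num)]
  rw [abs_of_nonneg (by linarith)] at h1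
  linarith

theorem norm_correction_le (hg : ContDiff ℝ 2 g) (hB : C2Bound g (4 * R) L) {U : H1 × L2}
    (hU : ‖U.1‖ ≤ R) (hU' : ‖U.2‖ ≤ R) :
    ‖(correction g U).1‖ + ‖(correction g U).2‖ ≤ 3 * L + 2 * (L * R) := by
  have hL := hB.nonneg
  have h1 : ‖(correction g U).1‖ ≤ 3 * L + L * R := by
    rw [correction, norm_neg]
    refine (H1.norm_le _).trans (add_le_add ?_ ?_)
    · rw [toL2_nonlinH1 hg]
      exact norm_nonlin_le hg hB hU
    · rw [deriv_nonlinH1 hg]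
      exact (norm_nonlinDeriv_le hg hB hU _).trans
        (mul_le_mul_of_nonneg_left ((H1.norm_deriv_le _).trans hU) hL)
  have h2 : ‖(correction g U).2‖ ≤ L * R :=
    (norm_nonlinDeriv_le hg hB hU _).trans (mul_le_mul_of_nonneg_left hU' hL)
  linarith

/-- The displacement produced by the increment of one step is `τ² / 2 · g(u)` up to third order. -/
theorem norm_disp_waveGroup_increment_sub_le (hg : ContDiff ℝ 2 g) (hB : C2Bound g (4 * R) L)
    {τ : ℝ} (hτ : 0 < τ) {U : H1 × L2} (hU : ‖U.1‖ ≤ R) (hU' : ‖U.2‖ ≤ R) :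
    ‖disp (waveGroup τ (increment g τ U)) - (τ ^ 2 / 2) • nonlin g U.1‖
      ≤ τ ^ 3 * (6 * L + 8 * (L * R)) := by
  have hL := hB.nonneg
  have hR : 0 ≤ R := (norm_nonneg _).trans hU
  set G := nonlin g U.1 with hG
  set W : H1 × L2 := (-(τ ^ 2 / 2) • nonlinH1 g U.1, τ • G) with hW
  have hGw : IsWeakDeriv G (nonlinDeriv g U.1 (H1.deriv U.1)) := isWeakDeriv_nonlin hg U.1
  have hG' : ‖nonlinDeriv g U.1 (H1.deriv U.1)‖ ≤ L * R :=
    (norm_nonlinDeriv_le hg hB hU _).trans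
      (mul_le_mul_of_nonneg_left ((H1.norm_deriv_le _).trans hU) hL)
  have hdW : disp W = -(τ ^ 2 / 2) • G := by
    rw [disp_apply, hW, map_smul, toL2_nonlinH1 hg]
  -- the displacement of the increment
  have h1 : ‖disp (increment g τ U - W)‖ ≤ τ ^ 2 * (2 * τ * (3 * L + 2 * (L * R))) := by
    have hc := continuous_waveGroup (correction g U)
    have e : disp (increment g τ U - W) = ∫ s in (0 : ℝ)..τ, (τ - s) •
        (disp (waveGroup (-2 * s) (correction g U)) - disp (correction g U)) := by
      simp only [smul_sub]
      rw [intervalIntegral.integral_sub (Continuous.intervalIntegrable (by fun_prop) _ _)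
        (Continuous.intervalIntegrable (by fun_prop) _ _), intervalIntegral.integral_smul_const,
        integral_weight, disp_correction hg, map_sub, disp_increment hτ, hdW, smul_neg, neg_smul]
    rw [e]
    refine norm_weighted_integral_le hτ.le fun s hs => ?_
    refine (norm_disp_waveGroup_sub_le _ _).trans ?_
    refine mul_le_mul ?_ (norm_correction_le hg hB hU hU') (by positivity) (by positivity)
    rw [abs_mul, abs_of_nonneg hs.1]
    norm_num
    exact hs.2
  -- the velocity of the increment
  have h2 : ‖(increment g τ U - W).2‖ ≤ τ ^ 2 * (2 * (L * R)) := by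
    have hc : ∀ ε : ℝ, (ε = 1 ∨ ε = -1) →
        ‖char ε (increment g τ U) - τ • G‖ ≤ τ ^ 2 * (2 * (L * R)) := by
      intro ε hε
      have hε' : -ε = 1 ∨ -ε = -1 := by rcases hε with rfl | rfl <;> simp
      rw [char_increment hg hε hτ, add_sub_cancel_left]
      refine norm_weighted_integral_le hτ.le fun s _ => ?_
      rw [norm_translate]
      refine (norm_nonlinDeriv_le hg hB hU _).trans ?_
      have := mul_le_mul_of_nonneg_left ((norm_char_le hε' U).trans (add_le_add hU hU')) hL
      linarith
    have e : (increment g τ U - W).2 = (1 / 2 : ℝ) • ((char 1 (increment g τ U) - τ • G)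
        + (char (-1) (increment g τ U) - τ • G)) := by
      rw [Prod.snd_sub, snd_eq_char (increment g τ U)]
      module
    rw [e, norm_smul, Real.norm_of_nonneg (by norm_num)]
    have := norm_add_le (char 1 (increment g τ U) - τ • G) (char (-1) (increment g τ U) - τ • G)
    linarith [hc 1 (Or.inl rfl), hc (-1) (Or.inr rfl)]
  have h3 : ‖disp (waveGroup τ W) - (τ ^ 2 / 2) • G‖ ≤ τ ^ 3 * (2 * (L * R)) := by
    have e : disp (waveGroup τ W) - (τ ^ 2 / 2) • G
        = τ • ((1 / 2 : ℝ) • (∫ r in (-τ)..τ, translate r G) - τ • G)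
          - (τ ^ 2 / 4) • ((translate τ G - G) + (translate (-τ) G - G)) := by
      have e1 : ∫ r in (-τ)..τ, translate r (τ • G) = τ • ∫ r in (-τ)..τ, translate r G := by
        simp only [map_smul]
        rw [intervalIntegral.integral_smul]
      rw [disp_waveGroup, hdW, e1, map_smul, map_smul]
      module
    have h4 := norm_half_integral_translate_sub_le hGw hτ.le
    have h5 := norm_translate_sub_le hGw τ
    have h6 := norm_translate_sub_le hGw (-τ)
    rw [abs_neg] at h6
    rw [abs_of_pos hτ] at h5 h6
    rw [e]
    refine (norm_sub_le _ _).trans ?_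
    rw [norm_smul, norm_smul, Real.norm_of_nonneg hτ.le, Real.norm_of_nonneg (by positivity)]
    have h7 : ‖(translate τ G - G) + (translate (-τ) G - G)‖ ≤ 2 * (L * R * τ) := by
      have := mul_le_mul_of_nonneg_right hG' hτ.le
      linarith [norm_add_le (translate τ G - G) (translate (-τ) G - G)]
    have h8 : τ * ‖(1 / 2 : ℝ) • (∫ r in (-τ)..τ, translate r G) - τ • G‖
        ≤ τ * (τ ^ 2 * (L * R)) :=
      mul_le_mul_of_nonneg_left (h4.trans (mul_le_mul_of_nonneg_left hG' (by positivity))) hτ.le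
    have h9 := mul_le_mul_of_nonneg_left h7 (by positivity : 0 ≤ τ ^ 2 / 4)
    have h10 : 0 ≤ τ ^ 3 * (L * R) := by positivity
    linarith
  have e : disp (waveGroup τ (increment g τ U)) - (τ ^ 2 / 2) • G
      = disp (waveGroup τ (increment g τ U - W)) + (disp (waveGroup τ W) - (τ ^ 2 / 2) • G) := by
    rw [disp_waveGroup_sub]
    abel
  rw [e]
  refine (norm_add_le _ _).trans ?_
  have h4 := norm_disp_waveGroup_le τ (increment g τ U - W)
  rw [abs_of_pos hτ] at h4
  have h5 := mul_le_mul_of_nonneg_left h2 hτ.le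
  linarith

/-- Local error of one step in the displacement, measured in `L²`. -/
theorem norm_disp_local_error_le (hg : ContDiff ℝ 2 g) (hB : C2Bound g (4 * R) L)
    (hs : IsSemilinearWaveSolution g T u v) (hu : ∀ t ∈ Icc 0 T, ‖u t‖ ≤ R)
    (hv : ∀ t ∈ Icc 0 T, ‖v t‖ ≤ R) {t τ : ℝ} (ht : 0 ≤ t) (hτ0 : 0 < τ) (hτ : t + τ ≤ T) :
    ‖disp ((u (t + τ), v (t + τ)) - correctedLieStep g τ (u t, v t))‖
      ≤ τ ^ 3 * (6 * L + 10 * (L * R)) := by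
  have hL := hB.nonneg
  have htT : t ∈ Icc 0 T := ⟨ht, by linarith⟩
  have hR : 0 ≤ R := (norm_nonneg _).trans (hu t htT)
  set U : H1 × L2 := (u t, v t) with hU
  set G := nonlin g (u t)
  have hmaps : MapsTo (fun r => t + r) (Icc 0 τ) (Icc 0 T) := fun r hr =>
    ⟨by linarith [hr.1], by linarith [hr.2]⟩
  have hd : ∀ s ∈ Icc 0 τ, HasDerivWithinAt
      (fun s => H1.toL2 (u (t + s)) - disp (waveGroup s U) - (s ^ 2 / 2) • G)
      (v (t + s) - (waveGroup s U).2 - s • G) (Icc 0 τ) s := by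
    intro s hsτ
    have h1 := hasDerivWithinAt_shift ht hτ (hs.hasDerivWithinAt_u (t + s) (hmaps hsτ))
    have h2 : HasDerivWithinAt (fun s => disp (waveGroup s U)) (waveGroup s U).2 (Icc 0 τ) s :=
      ((isWaveSolution_waveGroup U).hasDerivWithinAt_u s (mem_univ _)).mono (subset_univ _)
    have h3 : HasDerivWithinAt (fun s : ℝ => s ^ 2 / 2) s (Icc 0 τ) s := by
      have := ((hasDerivAt_pow 2 s).div_const 2).hasDerivWithinAt (s := Icc 0 τ)
      refine this.congr_deriv ?_
      push_cast
      ring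
    exact (h1.fun_sub h2).fun_sub (h3.smul_const G)
  have hb : ∀ s ∈ Ico 0 τ, ‖v (t + s) - (waveGroup s U).2 - s • G‖ ≤ 2 * L * R * τ ^ 2 := by
    intro s hsτ
    have hsτ' := Ico_subset_Icc_self hsτ
    have e : v (t + s) - (waveGroup s U).2 - s • G
        = (1 / 2 : ℝ) • ((char 1 (u (t + s), v (t + s)) - translate (1 * s) (char 1 U) - s • G)
          + (char (-1) (u (t + s), v (t + s)) - translate (-1 * s) (char (-1) U) - s • G)) := by
      have e1 := snd_eq_char (u (t + s), v (t + s))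
      rw [snd_eq_char (waveGroup s U), char_waveGroup (Or.inl rfl), char_waveGroup (Or.inr rfl)]
      change v (t + s) = _ at e1
      conv_lhs => rw [e1]
      module
    have hc : ∀ ε : ℝ, (ε = 1 ∨ ε = -1) →
        ‖char ε (u (t + s), v (t + s)) - translate (ε * s) (char ε U) - s • G‖
          ≤ 2 * L * R * τ ^ 2 := by
      intro ε hε
      have h := norm_char_sub_translate_sub_le hg hB hs hu hv hε ht
        (le_add_of_nonneg_right hsτ.1) (hmaps hsτ').2
      rw [add_sub_cancel_left] at h
      refine h.trans (mul_le_mul_of_nonneg_left (pow_le_pow_left₀ hsτ.1 hsτ'.2 2) (by positivity))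
    rw [e, norm_smul, Real.norm_of_nonneg (by norm_num)]
    refine (mul_le_mul_of_nonneg_left (norm_add_le _ _) (by norm_num)).trans ?_
    linarith [hc 1 (Or.inl rfl), hc (-1) (Or.inr rfl)]
  have hmv := norm_image_sub_le_of_norm_deriv_le_segment' hd hb τ (right_mem_Icc.2 hτ0.le)
  have e0 : H1.toL2 (u (t + 0)) - disp (waveGroup 0 U) - ((0 : ℝ) ^ 2 / 2) • G = 0 := by
    rw [add_zero, waveGroup_zero, disp_apply, hU]
    simp
  rw [e0, sub_zero, sub_zero] at hmv
  have hinc := norm_disp_waveGroup_increment_sub_le hg hB hτ0 (U := U) (hu t htT) (hv t htT)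
  have e : disp ((u (t + τ), v (t + τ)) - correctedLieStep g τ U)
      = (H1.toL2 (u (t + τ)) - disp (waveGroup τ U) - (τ ^ 2 / 2) • G)
        - (disp (waveGroup τ (increment g τ U)) - (τ ^ 2 / 2) • G) := by
    rw [map_sub, correctedLieStep_eq, disp_waveGroup_add, disp_apply (u (t + τ), v (t + τ))]
    abel
  rw [e]
  refine (norm_sub_le _ _).trans ?_
  change ‖disp (waveGroup τ (increment g τ U)) - (τ ^ 2 / 2) • G‖ ≤ _ at hinc
  linarith

end LocalError

/-! ### Summation of the local errors -/

section Global

variable {g : ℝ → ℝ} {T : ℝ} {u : ℝ → H1} {v : ℝ → L2} {R L : ℝ}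

/-- The overlaps of the two profiles over the time steps sum to a constant that does not depend on
the step size. -/
theorem exists_sum_overlap_le (T R c : ℝ) (hc : 0 ≤ c) :
    ∃ B : ℝ, 0 ≤ B ∧ ∀ U : H1 × L2, ‖U.1‖ ≤ R → ‖U.2‖ ≤ R → ∀ ε : ℝ, ε = 1 ∨ ε = -1 →
      ∀ τ : ℝ, 0 ≤ τ → ∀ N : ℕ, N * τ ≤ T →
        (∀ n < N, overlap ε (profile ε c U) (profile (-ε) c U) (n * τ) (n * τ + τ) ≠ ⊤) ∧
        ∑ n ∈ Finset.range N,
          (overlap ε (profile ε c U) (profile (-ε) c U) (n * τ) (n * τ + τ)).toReal ≤ B := by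
  obtain ⟨m, hm⟩ := exists_overlap_le T
  set b : ℝ := 2 * (R + R) ^ 2 + 14 * c ^ 2
  have hb : 0 ≤ b := by positivity
  refine ⟨m * b * b, by positivity, fun U hU hU' ε hε τ hτ N hN => ?_⟩
  have hε' : -ε = 1 ∨ -ε = -1 := by rcases hε with rfl | rfl <;> simp
  have hp : ∀ ε : ℝ, (ε = 1 ∨ ε = -1) →
      ∫⁻ x, profile ε c U x ^ 2 ≤ ENNReal.ofReal b := by
    intro ε hε
    refine (lintegral_profile_sq_le ε hc U).trans (ENNReal.ofReal_le_ofReal ?_)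
    have h1 := (norm_char_le hε U).trans (add_le_add hU hU')
    have h2 := pow_le_pow_left₀ (norm_nonneg _) h1 2
    simp only [b]
    linarith
  have htot : ∑ n ∈ Finset.range N, overlap ε (profile ε c U) (profile (-ε) c U) (n * τ)
      (n * τ + τ) ≤ ENNReal.ofReal (m * b * b) := by
    rw [sum_overlap ε _ _ hτ]
    refine (overlap_mono ε _ _ hN).trans ((hm ε hε _ _ (measurable_profile _ _ _)
      (measurable_profile _ _ _)).trans ?_)
    rw [ENNReal.ofReal_mul (by positivity), ENNReal.ofReal_mul (by positivity),
      ENNReal.ofReal_natCast]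
    gcongr
    · exact hp ε hε
    · exact hp (-ε) hε'
  have hfin : ∀ n ∈ Finset.range N,
      overlap ε (profile ε c U) (profile (-ε) c U) (n * τ) (n * τ + τ) ≠ ⊤ :=
    ENNReal.sum_ne_top.1 (ne_top_of_le_ne_top ENNReal.ofReal_ne_top htot)
  refine ⟨fun n hn => hfin n (Finset.mem_range.2 hn), ?_⟩
  rw [← ENNReal.toReal_sum hfin]
  exact ENNReal.toReal_le_of_le_ofReal (by positivity) htot

/-- Local error of one step in the norm `charNorm`. -/
theorem charNorm_local_error_le (hg : ContDiff ℝ 2 g) (hB : C2Bound g (4 * R) L)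
    (hs : IsSemilinearWaveSolution g T u v) (hu : ∀ t ∈ Icc 0 T, ‖u t‖ ≤ R)
    (hv : ∀ t ∈ Icc 0 T, ‖v t‖ ≤ R) {t τ : ℝ} (ht : 0 ≤ t) (hτ0 : 0 < τ) (hτ : t + τ ≤ T)
    {o : ℝ → ℝ≥0∞} (ho : ∀ ε, o ε = overlap ε (profile ε (L * T) (u 0, v 0))
      (profile (-ε) (L * T) (u 0, v 0)) t (t + τ)) (h1 : o 1 ≠ ⊤) (h2 : o (-1) ≠ ⊤) :
    charNorm ((u (t + τ), v (t + τ)) - correctedLieStep g τ (u t, v t))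
      ≤ τ ^ 2 * ((6 * L ^ 2 + 7 * L + 10 * (L * R)) * τ
          + L / 2 * ((o 1).toReal + (o (-1)).toReal)) := by
  rw [ho] at h1 h2
  have hc1 := norm_char_local_error_le hg hB hs hu (Or.inl rfl) ht hτ0 hτ h1
  have hc2 := norm_char_local_error_le hg hB hs hu (Or.inr rfl) ht hτ0 hτ h2
  have hd := norm_disp_local_error_le hg hB hs hu hv ht hτ0 hτ
  rw [charNorm, ho, ho]
  linarith

/-- Summation of the local errors.  The Lipschitz bound of one step is available as long as the
error is at most one, which the resulting estimate guarantees for small step sizes. -/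
theorem charNorm_error_le (hg : ContDiff ℝ 2 g) (hB : C2Bound g (4 * (R + 1)) L)
    (hR : 0 ≤ R) (hu : ∀ t ∈ Icc 0 T, ‖u t‖ ≤ R)
    (hv : ∀ t ∈ Icc 0 T, ‖v t‖ ≤ R) {τ K E : ℝ} (hτ0 : 0 < τ) (hτ1 : τ ≤ 1)
    (hK : K = 1 + 4 * L + 5 * (L + 8 * L * (R + 1))) {d : ℕ → ℝ} (hd : ∀ n, 0 ≤ d n)
    (hloc : ∀ n : ℕ, (n + 1) * τ ≤ T →
      charNorm ((u ((n + 1) * τ), v ((n + 1) * τ)) - correctedLieStep g τ (u (n * τ), v (n * τ)))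
        ≤ τ ^ 2 * d n)
    (hsum : ∀ n : ℕ, n * τ ≤ T → ∑ k ∈ Finset.range n, d k ≤ E)
    (hsmall : Real.exp (K * T) * (τ ^ 2 * E) ≤ 1) (n : ℕ) (hn : n * τ ≤ T) :
    charNorm ((u (n * τ), v (n * τ)) - correctedLie g τ (u 0, v 0) n)
      ≤ Real.exp (K * (n * τ)) * (τ ^ 2 * ∑ k ∈ Finset.range n, d k) := by
  have hL := hB.nonneg
  have hK0 : 0 ≤ K := by rw [hK]; positivity
  induction n with
  | zero => simp [correctedLie, charNorm]
  | succ n ih =>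
    have hn' : (n : ℝ) * τ ≤ T := by
      push_cast at hn
      linarith
    have hnT : (n : ℝ) * τ ∈ Icc 0 T := ⟨by positivity, hn'⟩
    have ih := ih hn'
    set V := (u (n * τ), v (n * τ)) with hV
    set W := correctedLie g τ (u 0, v 0) n with hW
    set s := ∑ k ∈ Finset.range n, d k with hs
    have hs0 : 0 ≤ s := Finset.sum_nonneg fun k _ => hd k
    have he1 : charNorm (V - W) ≤ 1 := by
      refine ih.trans (le_trans ?_ hsmall)
      have h1 : Real.exp (K * (n * τ)) ≤ Real.exp (K * T) :=
        Real.exp_le_exp.2 (mul_le_mul_of_nonneg_left hn' hK0)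
      have h2 := hsum n hn'
      gcongr
    have hW1 : ‖W.1‖ ≤ R + 1 := by
      have h1 : ‖V.1 - W.1‖ ≤ 1 := (norm_fst_le_charNorm (V - W)).trans he1
      have h3 := norm_sub_norm_le W.1 V.1
      rw [norm_sub_rev] at h3
      have h4 : ‖V.1‖ ≤ R := hu _ hnT
      linarith
    have hW2 : ‖W.2‖ ≤ R + 1 := by
      have h1 : ‖V.2 - W.2‖ ≤ 1 := (norm_snd_le_charNorm (V - W)).trans he1
      have h3 := norm_sub_norm_le W.2 V.2
      rw [norm_sub_rev] at h3
      have h4 : ‖V.2‖ ≤ R := hv _ hnT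
      linarith
    have hstab := charNorm_correctedLieStep_sub_le hg hB hτ0 hτ1 (U := V) (V := W)
      ((hu _ hnT).trans (by linarith)) hW1 hW2
    rw [← hK] at hstab
    have hl := hloc n (by push_cast at hn; exact hn)
    rw [← hV] at hl
    push_cast
    have e : (u ((n + 1) * τ), v ((n + 1) * τ)) - correctedLie g τ (u 0, v 0) (n + 1)
        = ((u ((n + 1) * τ), v ((n + 1) * τ)) - correctedLieStep g τ V)
          + (correctedLieStep g τ V - correctedLieStep g τ W) := by
      rw [sub_add_sub_cancel]
      rfl
    rw [e, Finset.sum_range_succ, ← hs]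
    refine (charNorm_add_le _ _).trans ?_
    have h1 : 1 + τ * K ≤ Real.exp (K * τ) := by
      have := Real.add_one_le_exp (K * τ)
      linarith
    have h2 : Real.exp (K * ((n + 1) * τ)) = Real.exp (K * τ) * Real.exp (K * (n * τ)) := by
      rw [← Real.exp_add]
      congr 1
      ring
    have h3 : (1 + τ * K) * charNorm (V - W)
        ≤ Real.exp (K * τ) * (Real.exp (K * (n * τ)) * (τ ^ 2 * s)) :=
      mul_le_mul h1 ih (charNorm_nonneg _) (Real.exp_pos _).le
    have h4 : 1 ≤ Real.exp (K * ((n + 1) * τ)) := Real.one_le_exp (by positivity)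
    have h5 : τ ^ 2 * d n ≤ Real.exp (K * ((n + 1) * τ)) * (τ ^ 2 * d n) :=
      le_mul_of_one_le_left (mul_nonneg (by positivity) (hd n)) h4
    have h6 : Real.exp (K * ((n + 1) * τ)) * (τ ^ 2 * s)
        = Real.exp (K * τ) * (Real.exp (K * (n * τ)) * (τ ^ 2 * s)) := by
      rw [h2, mul_assoc]
    rw [mul_add, mul_add, h6]
    linarith

end Global

end

end WaveTorus

open WaveTorus in
theorem theorem1p3 (g : ℝ → ℝ) (hg : ContDiff ℝ 2 g) (T : ℝ) (hT : 0 < T) (M₁ M₂ : ℝ) :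
    ∃ C > 0, ∃ τ₀ > 0, ∀ (u : ℝ → WaveTorus.H1) (v : ℝ → WaveTorus.L2),
      WaveTorus.IsSemilinearWaveSolution g T u v →
      (∀ t ∈ Set.Icc 0 T, ‖u t‖ ≤ M₁) →
      (∀ t ∈ Set.Icc 0 T, ‖v t‖ ≤ M₂) →
      ∀ τ : ℝ, 0 < τ → τ ≤ τ₀ → ∀ n : ℕ, n * τ ≤ T →
        ‖u (n * τ) - (WaveTorus.correctedLie g τ (u 0, v 0) n).1‖
          + ‖v (n * τ) - (WaveTorus.correctedLie g τ (u 0, v 0) n).2‖ ≤ C * τ ^ 2 := by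
  set R : ℝ := |M₁| + |M₂| with hRdef
  have hR : 0 ≤ R := by positivity
  obtain ⟨L, hB⟩ := exists_c2Bound hg (4 * (R + 1))
  have hL := hB.nonneg
  obtain ⟨B, hB0, hov⟩ := exists_sum_overlap_le T (R + 1) (L * T) (by positivity)
  set K : ℝ := 1 + 4 * L + 5 * (L + 8 * L * (R + 1)) with hK
  set C₁ : ℝ := 6 * L ^ 2 + 7 * L + 10 * (L * (R + 1)) with hC₁
  have hC₁0 : 0 ≤ C₁ := by positivity
  set E : ℝ := C₁ * T + L / 2 * (B + B) with hE
  have hE0 : 0 ≤ E := by positivity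
  have hKE : 0 ≤ Real.exp (K * T) * E := by positivity
  refine ⟨2 * (Real.exp (K * T) * E) + 1, by positivity,
    min 1 (1 / (Real.exp (K * T) * E + 1)), by positivity, ?_⟩
  intro u v hs hu hv τ hτ0 hτ n hn
  have hu' : ∀ t ∈ Set.Icc 0 T, ‖u t‖ ≤ R := fun t ht => (hu t ht).trans
    ((le_abs_self M₁).trans (le_add_of_nonneg_right (abs_nonneg _)))
  have hv' : ∀ t ∈ Set.Icc 0 T, ‖v t‖ ≤ R := fun t ht => (hv t ht).trans
    ((le_abs_self M₂).trans (le_add_of_nonneg_left (abs_nonneg _)))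
  have hu'' : ∀ t ∈ Set.Icc 0 T, ‖u t‖ ≤ R + 1 := fun t ht => (hu' t ht).trans (by linarith)
  have hv'' : ∀ t ∈ Set.Icc 0 T, ‖v t‖ ≤ R + 1 := fun t ht => (hv' t ht).trans (by linarith)
  have h0T : (0 : ℝ) ∈ Set.Icc 0 T := Set.left_mem_Icc.2 hT.le
  have hτ1 : τ ≤ 1 := hτ.trans (min_le_left _ _)
  have hsmall : Real.exp (K * T) * (τ ^ 2 * E) ≤ 1 := by
    have h1 : τ * (Real.exp (K * T) * E + 1) ≤ 1 :=
      (le_div_iff₀ (by positivity)).1 (hτ.trans (min_le_right _ _))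
    have h2 : τ ^ 2 ≤ τ := by nlinarith
    have h3 := mul_le_mul_of_nonneg_right h2 hKE
    linarith
  set o : ℕ → ℝ → ENNReal := fun k ε => overlap ε (profile ε (L * T) (u 0, v 0))
    (profile (-ε) (L * T) (u 0, v 0)) (k * τ) (k * τ + τ) with ho
  have hov' := fun ε hε => hov (u 0, v 0) (hu'' 0 h0T) (hv'' 0 h0T) ε hε τ hτ0.le
  set d : ℕ → ℝ := fun k => C₁ * τ + L / 2 * ((o k 1).toReal + (o k (-1)).toReal) with hd
  have hd0 : ∀ k, 0 ≤ d k := fun k => by positivity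
  have hsum : ∀ m : ℕ, m * τ ≤ T → ∑ k ∈ Finset.range m, d k ≤ E := by
    intro m hm
    rw [Finset.sum_add_distrib, Finset.sum_const, Finset.card_range, nsmul_eq_mul,
      ← Finset.mul_sum, Finset.sum_add_distrib]
    have h1 : ∑ k ∈ Finset.range m, (o k 1).toReal ≤ B := (hov' 1 (Or.inl rfl) m hm).2
    have h2 : ∑ k ∈ Finset.range m, (o k (-1)).toReal ≤ B := (hov' (-1) (Or.inr rfl) m hm).2
    have h3 := mul_le_mul_of_nonneg_left hm hC₁0
    have h4 := mul_le_mul_of_nonneg_left (add_le_add h1 h2) (by positivity : 0 ≤ L / 2)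
    linarith
  have hloc : ∀ m : ℕ, (m + 1) * τ ≤ T →
      charNorm ((u ((m + 1) * τ), v ((m + 1) * τ))
        - correctedLieStep g τ (u (m * τ), v (m * τ))) ≤ τ ^ 2 * d m := by
    intro m hm
    have hm' : ((m + 1 : ℕ) : ℝ) * τ ≤ T := by
      push_cast
      exact hm
    have e : ((m : ℝ) + 1) * τ = m * τ + τ := by ring
    rw [e] at hm ⊢
    exact charNorm_local_error_le hg hB hs hu'' hv'' (by positivity) hτ0 hm (o := o m)
      (fun ε => rfl) ((hov' 1 (Or.inl rfl) (m + 1) hm').1 m m.lt_succ_self)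
      ((hov' (-1) (Or.inr rfl) (m + 1) hm').1 m m.lt_succ_self)
  have hmain := charNorm_error_le hg hB hR hu' hv' hτ0 hτ1 hK hd0 hloc hsum hsmall n hn
  have hexp : Real.exp (K * (n * τ)) * (τ ^ 2 * ∑ k ∈ Finset.range n, d k)
      ≤ Real.exp (K * T) * (τ ^ 2 * E) := by
    have h1 : Real.exp (K * (n * τ)) ≤ Real.exp (K * T) :=
      Real.exp_le_exp.2 (mul_le_mul_of_nonneg_left hn (by positivity))
    have h2 := hsum n hn
    have h3 : 0 ≤ ∑ k ∈ Finset.range n, d k := Finset.sum_nonneg fun k _ => hd0 k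
    gcongr
  have h1 := norm_fst_le_charNorm ((u (n * τ), v (n * τ)) - correctedLie g τ (u 0, v 0) n)
  have h2 := norm_snd_le_charNorm ((u (n * τ), v (n * τ)) - correctedLie g τ (u 0, v 0) n)
  rw [Prod.fst_sub] at h1
  rw [Prod.snd_sub] at h2
  have h3 : 0 ≤ τ ^ 2 := by positivity
  linarith
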